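/- **Language.** Expressions are $e ::= x \mid \lambda x.e \mid (e\,e') \mid d(e)$, where $d$ ranges over distribution symbols; deterministic expressions are $e_v ::= x \mid \lambda x.e_v \mid (e_v\,e_v')$. A program is a finite sequence of statements $\mathsf{assume}\ x=e$ and $\mathsf{observe}(d(e)=e_v)$. Values are $v ::= x \mid \langle \lambda x.e,\sigma\rangle \mid (v\,v')$, with $\sigma$ a finite environment. For each $d$ and value $v$ there are a set $d(v)$ of possible outcomes (deterministic expressions) and a probability mass function $\mathrm{pdf}_d(v,\cdot)$ vanishing outside $d(v)$. The free variables of $d(e)$ include those of the possible outcomes of $d$, and renaming $d(e)$ renames its outcomes too. Programs obey the variable convention: only ordinary names are written, no name is assumed twice, and no name occurs free before or in the statement that assumes it. **Traces.** Execution is call by value with environments, starting from the empty environment. A variable evaluates to its value in the environment, or to itself if unbound; $\lambda x.e$ evaluates to the closure whose environment is the current one restricted to the free variables of $\lambda x.e$; an application $(e_1\,e_2)$ whose function evaluates to $\langle\lambda y.e,\sigma\rangle$ evaluates $e[z/y]$ in $\sigma[z\mapsto \text{value of } e_2]$ with $z$ fresh, and otherwise gives a symbolic application; $d(e)$ evaluates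 $e$ to $v$, draws some $e_v\in d(v)$ and evaluates $e_v$; $\mathsf{assume}\ x=e$ binds $x$ to the value of $e$; $\mathsf{observe}(d(e)=e_v)$ evaluates $e$ to $v$ and requires $e_v\in d(v)$. A trace records the evaluation of every subexpression, each with a unique identifier, and each stochastic choice has an identifier of its own. Identifiers and fresh names are chosen canonically (by position of execution), and subexpressions keep theirs when a trace is rolled back to the program $\mathsf{Program}(t)$ underlying it. $T_p$ is the set of valid traces of $p$, with the $\sigma$-algebra $\Sigma_p$ of all subsets. The density $\mathrm{pdf}(t)$ is the product of the $\mathrm{pdf}_d(v,e_v)$ over all draws and observations in $t$, and $\mu_p(A)=\sum_{t\in A}\mathrm{pdf}(t)\big/\sum_{t\in T_p}\mathrm{pdf}(t)$. **Subproblems.** The nodes of the dependence graph of $t$ are the identifiers in $t$; those of stochastic choices and observations are sample nodes. Data edges go: to a variable occurrence, from the expression that assigned the variable; to an application, from its function and from the evaluated body (closure) or the argument (symbolic); to a stochastic choice or observation, from its parameter; to $d(e)$, from its choice and from the evaluated draw. Existential edges go from the function of a closure application to all nodes of the evaluated body, and from a stochastic choice to all nodes of the evaluated draw. A set $S$ of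 nodes is a valid subproblem of $t$ if all existential edges leaving a node of $S$ end in $S$ and every data edge from $S$ to outside $S$ ends at a sample node. Write $S\vdash t\equiv t'$ if $t,t'$ coincide up to computed values, except that at a stochastic choice in $S$ the draw and its evaluation are arbitrary, and at an application whose function is in $S$ the kind of the application and the evaluated body are arbitrary. $\mathsf{ExtractTrace}(t,S)$ is obtained from $t$ as follows, going through the evaluated subexpressions in order: each stochastic choice $d(a)=a'$ outside $S$ with outcome $e_v$ is replaced by $a'$, preceded by $\mathsf{observe}(d(a)=e_v)$; each closure application $(a_1\,a_2)\,z=a_3$ with $a_1$ outside $S$ is replaced by $a_3$, preceded by $\mathsf{assume}\ x=a_1$ ($x$ fresh) and $\mathsf{assume}\ z=a_2$. Evaluated draws of choices in $S$, and evaluated bodies of applications with function in $S$, are left as they are. A strategy $\mathsf{SS}$ assigns to every $t\in T_p$ a valid subproblem $\mathsf{SS}(t)$; write $\mathsf{SS}\vdash t\equiv t'$ for $\mathsf{SS}(t)\vdash t\equiv t'$. It is reversible if for all $n\ge1$ and $t_1,\dots,t_n\in T_p$, $\mathsf{SS}\vdash t_i\equiv t_{i+1}$ for all $i<n$ implies $\mathsf{SS}\vdash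 t_n\equiv t_1$. Then $\mathsf{SS}\vdash\cdot\equiv\cdot$ is an equivalence relation on $T_p$. **Kernels.** A Markov kernel $K$ on a measurable space with a measure $\pi$ is $\pi$-irreducible if for every point $t$ and measurable $A$ with $\pi(A)>0$ there is $n\ge1$ with $K^n(t,A)>0$. It is periodic if for some $d\ge2$ the space is a disjoint union of non-empty measurable sets $E_0,\dots,E_{d-1}$ and a measurable $N$ with $\pi(N)=0$, such that $K(t,E_{(i+1)\bmod d})=1$ for all $i$ and $t\in E_i$; otherwise it is aperiodic. $\pi$ is stationary for $K$ if $\pi K=\pi$. **Theorem.** Let $p$ be a program, $\mathsf{SS}$ a reversible strategy on $T_p$, and $c_i$ an equivalence class with set of traces $T_{c_i}\subseteq T_p$ (with the induced $\sigma$-algebra $\Sigma_{c_i}$) such that $\mu_p(T_{c_i})>0$. Let $v_i(c_i,A)=\mu_p(A)/\mu_p(T_{c_i})$ for $A\in\Sigma_{c_i}$. Let $p_s$ be the subprogram of the class: $\mathsf{Program}(\mathsf{ExtractTrace}(t,\mathsf{SS}(t)))=p_s$ for all $t\in T_{c_i}$. Let $K$ be a Markov kernel on $(T_{p_s},\Sigma_{p_s})$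 that is $\mu_{p_s}$-irreducible and aperiodic, with stationary distribution $\mu_{p_s}$. Then $t_s:=\mathsf{ExtractTrace}(t,\mathsf{SS}(t))\in T_{p_s}$ for every $t\in T_{c_i}$, the formula $$K(c_i)(t,A)=K(t_s,A'),\qquad A'=\{\mathsf{ExtractTrace}(t',\mathsf{SS}(t')) : t'\in A\},$$ defines a Markov kernel $K(c_i)$ on $(T_{c_i},\Sigma_{c_i})$, and $K(c_i)$ is $v_i(c_i,\cdot)$-irreducible and aperiodic, with stationary distribution $v_i(c_i,\cdot)$. -/

import Mathlib

open MeasureTheory ProbabilityTheory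
open scoped ENNReal

universe u

namespace ProbLang

/-! ## Identifiers, variables, expressions, values -/

/-- Names that a programmer may write. -/
abbrev Name := ℕ

/-- Canonical unique identifiers of evaluated (sub)expressions and of stochastic choices: the
position in the execution. `stmt k` is the `k`-th statement, `left`, `right` are the two parts of an
application (`left` is also the parameter of a distribution), `body` is the instantiated function
body of an application, or the evaluated draw of a distribution, and `choice i` is the stochastic
choice made at `i`. Traces that differ only in the choice of identifiers and fresh names are thereby
represented by exactly one trace. -/
inductive ID : Type
  | stmt (k : ℕ)
  | left (i : ID)
  | right (i : ID)
  | body (i : ID)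
  | choice (i : ID)
  deriving DecidableEq

/-- Variables: source names, and the fresh names `arg i` (for the argument) and `fn i` (for the
function) that belong to the application with identifier `i`. -/
inductive Var : Type
  | src (x : Name)
  | arg (i : ID)
  | fn (i : ID)
  deriving DecidableEq

/-- Deterministic expressions `e_v ::= x | λ.x e_v | (e_v e_v')`, the possible draws of a
distribution. -/
inductive VExpr : Type
  | var (x : Name)
  | lam (x : Name) (b : VExpr)
  | app (e₁ e₂ : VExpr)

/-- Expressions `e ::= x | λ.x e | (e e') | Dist(e)`, with distribution symbols from `D`. The list
`ρ` in `dist d ρ e` records the renamings `[z/y]` that have been applied to the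
distribution, so it denotes the distribution whose draws are those of `d` renamed by `ρ`; it is
empty in source programs. -/
inductive Expr (D : Type u) : Type u
  | var (x : Var)
  | lam (x : Name) (b : Expr D)
  | app (e₁ e₂ : Expr D)
  | dist (d : D) (ρ : List (Name × Var)) (e : Expr D)

/-- Values `v ::= x | ⟨λ.x e, σ⟩ | (v v')`. -/
inductive Val (D : Type u) : Type u
  | sym (x : Var)
  | clo (x : Name) (b : Expr D) (σ : List (Var × Val D))
  | app (v₁ v₂ : Val D)

/-- Environments: finite maps from variables to values, the newest binding first. -/
abbrev Env (D : Type u) := List (Var × Val D)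

variable {D : Type u}

/-- Value of a variable in an environment. -/
def Env.get : Env D → Var → Option (Val D)
  | [], _ => none
  | (y, v) :: σ, x => if y = x then some v else Env.get σ x

open Classical in
/-- `RestrictKeys(σ, X)`. -/
noncomputable def Env.restrict (σ : Env D) (X : Set Var) : Env D :=
  σ.filter (fun q => q.1 ∈ X)

/-- The renaming `e[z/y]` of the free occurrences of the source name `y`. It acts on a distribution
by renaming its draws too. -/
def Expr.subst (y : Name) (z : Var) : Expr D → Expr D
  | .var w => if w = .src y then .var z else .var w
  | .lam x b => if x = y then .lam x b else .lam x (b.subst y z)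
  | .app e₁ e₂ => .app (e₁.subst y z) (e₂.subst y z)
  | .dist d ρ e => .dist d (ρ ++ [(y, z)]) (e.subst y z)

/-- Successive renamings of an expression. -/
def Expr.rename (ρ : List (Name × Var)) (e : Expr D) : Expr D :=
  ρ.foldl (fun e q => e.subst q.1 q.2) e

/-- The effect of successive renamings on a name. -/
def renameVar (ρ : List (Name × Var)) (x : Name) : Var :=
  ρ.foldl (fun w q => if w = .src q.1 then q.2 else w) (.src x)

def VExpr.toExpr : VExpr → Expr D
  | .var x => .var (.src x)
  | .lam x b => .lam x b.toExpr
  | .app e₁ e₂ => .app e₁.toExpr e₂.toExpr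

/-- Free names of a deterministic expression. -/
def VExpr.fv : VExpr → Set Name
  | .var x => {x}
  | .lam x b => b.fv \ {x}
  | .app e₁ e₂ => e₁.fv ∪ e₂.fv

/-- The distributions of the language: for every symbol `d` and parameter value `v` the set of
expressions that `Dist(v)` may return, and a probability distribution on expressions that is
concentrated on this set (a possible outcome may have density zero). -/
structure Dists (D : Type u) where
  outcomes : D → Val D → Set VExpr
  pmf : D → Val D → PMF VExpr
  support_subset : ∀ d v, (pmf d v).support ⊆ outcomes d v

/-- Free names of the possible outcomes of a distribution. -/
def Dists.fv (𝒟 : Dists D) (d : D) : Set Name :=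
  {x | ∃ v, ∃ e ∈ 𝒟.outcomes d v, x ∈ e.fv}

/-- Free variables; those of `Dist(e)` include the free variables of the possible outcomes. -/
def Expr.fv (𝒟 : Dists D) : Expr D → Set Var
  | .var x => {x}
  | .lam x b => b.fv 𝒟 \ {.src x}
  | .app e₁ e₂ => e₁.fv 𝒟 ∪ e₂.fv 𝒟
  | .dist d ρ e => e.fv 𝒟 ∪ renameVar ρ '' 𝒟.fv d

/-! ## Programs -/

/-- Statements `assume x = e` and `observe (d(e) = e_v)`. -/
inductive Stmt (D : Type u) : Type u
  | assume (x : Name) (e : Expr D)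
  | observe (d : D) (e : Expr D) (ev : VExpr)

abbrev Prog (D : Type u) := List (Stmt D)

def Stmt.expr : Stmt D → Expr D
  | .assume _ e => e
  | .observe _ e _ => e

/-- Names assigned by a program, in order. -/
def Prog.assigned : Prog D → List Name
  | [] => []
  | .assume x _ :: p => x :: Prog.assigned p
  | .observe _ _ _ :: p => Prog.assigned p

/-- An expression as a programmer writes it: only source names, distributions not yet renamed. -/
def Expr.IsSource : Expr D → Prop
  | .var x => ∃ n, x = .src n
  | .lam _ b => b.IsSource
  | .app e₁ e₂ => e₁.IsSource ∧ e₂.IsSource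
  | .dist _ ρ e => ρ = [] ∧ e.IsSource

/-- Variable convention: the program is written in source syntax, no name is assigned twice, and no
name occurs free before (or in) the statement that assigns it. -/
def Prog.WellFormed (𝒟 : Dists D) : Prog D → Prop
  | [] => True
  | s :: p => s.expr.IsSource ∧
      (∀ x ∈ Prog.assigned (s :: p), Var.src x ∉ s.expr.fv 𝒟) ∧
      (Prog.assigned (s :: p)).Nodup ∧
      Prog.WellFormed 𝒟 p

/-- Expressions in which every subexpression that is about to be evaluated carries its identifier
(the stochastic choice of `dist d ρ e i` has the identifier `i.choice`). -/
inductive LExpr (D : Type u) : Type u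
  | var (x : Var) (i : ID)
  | lam (x : Name) (b : Expr D) (i : ID)
  | app (e₁ e₂ : LExpr D) (i : ID)
  | dist (d : D) (ρ : List (Name × Var)) (e : LExpr D) (i : ID)

/-- Statements of programs whose expressions carry identifiers; `c` identifies the observation. -/
inductive LStmt (D : Type u) : Type u
  | assume (x : Var) (e : LExpr D)
  | observe (d : D) (e : LExpr D) (ev : VExpr) (c : ID)

abbrev LProg (D : Type u) := List (LStmt D)

/-- Attach identifiers to an expression that is evaluated at `i`. -/
def Expr.label : Expr D → ID → LExpr D
  | .var x, i => .var x i
  | .lam x b, i => .lam x b i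
  | .app e₁ e₂, i => .app (e₁.label i.left) (e₂.label i.right) i
  | .dist d ρ e, i => .dist d ρ (e.label i.left) i

def Prog.labelFrom : ℕ → Prog D → LProg D
  | _, [] => []
  | k, .assume x e :: p => .assume (.src x) (e.label (.stmt k)) :: Prog.labelFrom (k + 1) p
  | k, .observe d e ev :: p =>
      .observe d (e.label (ID.stmt k).left) ev (ID.stmt k).choice :: Prog.labelFrom (k + 1) p

/-- A program with the canonical identifiers of its statements and expressions. -/
def Prog.label (p : Prog D) : LProg D := Prog.labelFrom 0 p

/-! ## Traces -/

/-- Augmented expressions. `appC a₁ a₂ a₃ i` is the application `(a₁ a₂) y = a₃` of a closure, with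
the fresh variable `y = arg i`; `appS a₁ a₂ i` is the symbolic application `(a₁ a₂) ⊥`;
`dist d ρ a ev a' i` is `d(a # i.choice) = a'`, where `a'` is the evaluation of the drawn expression
`ev` (renamed by `ρ`). Values are stored at the leaves and determine all the others. -/
inductive AExpr (D : Type u) : Type u
  | var (x : Var) (v : Val D) (i : ID)
  | lam (x : Name) (b : Expr D) (v : Val D) (i : ID)
  | appC (a₁ a₂ a₃ : AExpr D) (i : ID)
  | appS (a₁ a₂ : AExpr D) (i : ID)
  | dist (d : D) (ρ : List (Name × Var)) (a : AExpr D) (ev : VExpr) (a' : AExpr D) (i : ID)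

inductive AStmt (D : Type u) : Type u
  | assume (x : Var) (a : AExpr D)
  | observe (d : D) (a : AExpr D) (ev : VExpr) (c : ID)

abbrev Trace (D : Type u) := List (AStmt D)

/-- The value of an augmented expression. -/
def AExpr.val : AExpr D → Val D
  | .var _ v _ => v
  | .lam _ _ v _ => v
  | .appC _ _ a₃ _ => a₃.val
  | .appS a₁ a₂ _ => .app a₁.val a₂.val
  | .dist _ _ _ _ a' _ => a'.val

/-- The identifier of an augmented expression. -/
def AExpr.id : AExpr D → ID
  | .var _ _ i => i
  | .lam _ _ _ i => i
  | .appC _ _ _ i => i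
  | .appS _ _ i => i
  | .dist _ _ _ _ _ i => i

/-- Execution of expressions (call by value, no evaluation under a lambda). -/
inductive Eval (𝒟 : Dists D) : Env D → LExpr D → AExpr D → Prop
  | free {σ : Env D} {x : Var} {i : ID} (h : σ.get x = none) :
      Eval 𝒟 σ (.var x i) (.var x (.sym x) i)
  | bound {σ : Env D} {x : Var} {v : Val D} {i : ID} (h : σ.get x = some v) :
      Eval 𝒟 σ (.var x i) (.var x v i)
  | lam {σ : Env D} {x : Name} {b : Expr D} {i : ID} :
      Eval 𝒟 σ (.lam x b i) (.lam x b (.clo x b (σ.restrict ((Expr.lam x b).fv 𝒟))) i)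
  | appC {σ σ' : Env D} {e₁ e₂ : LExpr D} {a₁ a₂ a₃ : AExpr D} {y : Name} {b : Expr D} {i : ID}
      (h₁ : Eval 𝒟 σ e₁ a₁) (h₂ : Eval 𝒟 σ e₂ a₂) (hv : a₁.val = .clo y b σ')
      (h₃ : Eval 𝒟 ((.arg i, a₂.val) :: σ') ((b.subst y (.arg i)).label i.body) a₃) :
      Eval 𝒟 σ (.app e₁ e₂ i) (.appC a₁ a₂ a₃ i)
  | appS {σ : Env D} {e₁ e₂ : LExpr D} {a₁ a₂ : AExpr D} {i : ID}
      (h₁ : Eval 𝒟 σ e₁ a₁) (h₂ : Eval 𝒟 σ e₂ a₂) (hv : ∀ y b σ', a₁.val ≠ .clo y b σ') :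
      Eval 𝒟 σ (.app e₁ e₂ i) (.appS a₁ a₂ i)
  | dist {σ : Env D} {d : D} {ρ : List (Name × Var)} {e : LExpr D} {a a' : AExpr D} {ev : VExpr}
      {i : ID} (h : Eval 𝒟 σ e a) (hev : ev ∈ 𝒟.outcomes d a.val)
      (h' : Eval 𝒟 σ ((ev.toExpr.rename ρ).label i.body) a') :
      Eval 𝒟 σ (.dist d ρ e i) (.dist d ρ a ev a' i)

/-- Execution of programs. -/
inductive Exec (𝒟 : Dists D) : Env D → LProg D → Trace D → Prop
  | nil {σ : Env D} : Exec 𝒟 σ [] []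
  | assume {σ : Env D} {x : Var} {e : LExpr D} {a : AExpr D} {p : LProg D} {t : Trace D}
      (h : Eval 𝒟 σ e a) (ht : Exec 𝒟 ((x, a.val) :: σ) p t) :
      Exec 𝒟 σ (.assume x e :: p) (.assume x a :: t)
  | observe {σ : Env D} {d : D} {e : LExpr D} {a : AExpr D} {ev : VExpr} {c : ID} {p : LProg D}
      {t : Trace D} (h : Eval 𝒟 σ e a) (hev : ev ∈ 𝒟.outcomes d a.val) (ht : Exec 𝒟 σ p t) :
      Exec 𝒟 σ (.observe d e ev c :: p) (.observe d a ev c :: t)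

/-- `Traces(P)`: the valid traces of a program. -/
def TraceSpace (𝒟 : Dists D) (P : LProg D) : Type u := {t : Trace D // Exec 𝒟 [] P t}

/-- All sets of traces are measurable: the trace space is countable and singletons are measurable. -/
instance (𝒟 : Dists D) (P : LProg D) : MeasurableSpace (TraceSpace 𝒟 P) := ⊤

/-- Rolling back an augmented expression. -/
def AExpr.roll : AExpr D → LExpr D
  | .var x _ i => .var x i
  | .lam x b _ i => .lam x b i
  | .appC a₁ a₂ _ i => .app a₁.roll a₂.roll i
  | .appS a₁ a₂ i => .app a₁.roll a₂.roll i
  | .dist d ρ a _ _ i => .dist d ρ a.roll i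

def AStmt.roll : AStmt D → LStmt D
  | .assume x a => .assume x a.roll
  | .observe d a ev c => .observe d a.roll ev c

/-- `Program(t)`: the program underlying a trace. -/
def Trace.program (t : Trace D) : LProg D := t.map AStmt.roll

/-! ## Dependence graphs and valid subproblems -/

/-- Nodes of the dependence graph. -/
def AExpr.nodes : AExpr D → Set ID
  | .var _ _ i => {i}
  | .lam _ _ _ i => {i}
  | .appC a₁ a₂ a₃ i => {i} ∪ a₁.nodes ∪ a₂.nodes ∪ a₃.nodes
  | .appS a₁ a₂ i => {i} ∪ a₁.nodes ∪ a₂.nodes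
  | .dist _ _ a _ a' i => {i, i.choice} ∪ a.nodes ∪ a'.nodes

/-- Nodes that make a stochastic choice. -/
def AExpr.samples : AExpr D → Set ID
  | .var _ _ _ => ∅
  | .lam _ _ _ _ => ∅
  | .appC a₁ a₂ a₃ _ => a₁.samples ∪ a₂.samples ∪ a₃.samples
  | .appS a₁ a₂ _ => a₁.samples ∪ a₂.samples
  | .dist _ _ a _ a' i => {i.choice} ∪ a.samples ∪ a'.samples

/-- Pairs of a variable bound by an application and the identifier of the argument it is bound to. -/
def AExpr.binders : AExpr D → Set (Var × ID)
  | .var _ _ _ => ∅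
  | .lam _ _ _ _ => ∅
  | .appC a₁ a₂ a₃ i => {(.arg i, a₂.id)} ∪ a₁.binders ∪ a₂.binders ∪ a₃.binders
  | .appS a₁ a₂ _ => a₁.binders ∪ a₂.binders
  | .dist _ _ a _ a' _ => a.binders ∪ a'.binders

/-- Data dependence edges, given which identifier each variable refers to. -/
def AExpr.dataEdges (β : Set (Var × ID)) : AExpr D → Set (ID × ID)
  | .var x _ i => {q | (x, q.1) ∈ β ∧ q.2 = i}
  | .lam _ _ _ _ => ∅
  | .appC a₁ a₂ a₃ i =>
      {(a₁.id, i), (a₃.id, i)} ∪ a₁.dataEdges β ∪ a₂.dataEdges β ∪ a₃.dataEdges β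
  | .appS a₁ a₂ i => {(a₁.id, i), (a₂.id, i)} ∪ a₁.dataEdges β ∪ a₂.dataEdges β
  | .dist _ _ a _ a' i =>
      {(a.id, i.choice), (a'.id, i), (i.choice, i)} ∪ a.dataEdges β ∪ a'.dataEdges β

/-- Existential edges. -/
def AExpr.existEdges : AExpr D → Set (ID × ID)
  | .var _ _ _ => ∅
  | .lam _ _ _ _ => ∅
  | .appC a₁ a₂ a₃ _ =>
      {q | q.1 = a₁.id ∧ q.2 ∈ a₃.nodes} ∪ a₁.existEdges ∪ a₂.existEdges ∪ a₃.existEdges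
  | .appS a₁ a₂ _ => a₁.existEdges ∪ a₂.existEdges
  | .dist _ _ a _ a' i =>
      {q | q.1 = i.choice ∧ q.2 ∈ a'.nodes} ∪ a.existEdges ∪ a'.existEdges

def AStmt.nodes : AStmt D → Set ID
  | .assume _ a => a.nodes
  | .observe _ a _ c => {c} ∪ a.nodes

def AStmt.samples : AStmt D → Set ID
  | .assume _ a => a.samples
  | .observe _ a _ c => {c} ∪ a.samples

def AStmt.binders : AStmt D → Set (Var × ID)
  | .assume x a => {(x, a.id)} ∪ a.binders
  | .observe _ a _ _ => a.binders

def AStmt.dataEdges (β : Set (Var × ID)) : AStmt D → Set (ID × ID)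
  | .assume _ a => a.dataEdges β
  | .observe _ a _ c => {(a.id, c)} ∪ a.dataEdges β

def AStmt.existEdges : AStmt D → Set (ID × ID)
  | .assume _ a => a.existEdges
  | .observe _ a _ _ => a.existEdges

def Trace.nodes (t : Trace D) : Set ID := {i | ∃ s ∈ t, i ∈ s.nodes}

def Trace.samples (t : Trace D) : Set ID := {i | ∃ s ∈ t, i ∈ s.samples}

/-- The identifier of the expression that assigned its value to a variable. -/
def Trace.binders (t : Trace D) : Set (Var × ID) := {q | ∃ s ∈ t, q ∈ s.binders}

def Trace.dataEdges (t : Trace D) : Set (ID × ID) :=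
  {q | ∃ s ∈ t, q ∈ s.dataEdges (Trace.binders t)}

def Trace.existEdges (t : Trace D) : Set (ID × ID) := {q | ∃ s ∈ t, q ∈ s.existEdges}

/-- Valid subproblems of a trace: no outgoing existential edges, and all outgoing data dependence
edges terminate at a stochastic choice. -/
def ValidSubproblem (t : Trace D) (S : Set ID) : Prop :=
  S ⊆ Trace.nodes t ∧
  (∀ i ∈ S, ∀ j, (i, j) ∈ Trace.existEdges t → j ∈ S) ∧
  (∀ i ∈ S, ∀ j, (i, j) ∈ Trace.dataEdges t → j ∉ S → j ∈ Trace.samples t)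

/-! ## Subproblem equivalence and trace extraction -/

/-- `a` is an application of `a₁` to `a₂` with identifier `i`, symbolic or not. -/
def AExpr.IsApp (a a₁ a₂ : AExpr D) (i : ID) : Prop :=
  a = .appS a₁ a₂ i ∨ ∃ a₃, a = .appC a₁ a₂ a₃ i

/-- `S ⊢ a ≡ a'` on augmented expressions. -/
inductive AExpr.Equiv (S : Set ID) : AExpr D → AExpr D → Prop
  | var {x : Var} {v v' : Val D} {i : ID} : Equiv S (.var x v i) (.var x v' i)
  | lam {x : Name} {b : Expr D} {v v' : Val D} {i : ID} : Equiv S (.lam x b v i) (.lam x b v' i)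
  | appC {a₁ a₂ a₃ b₁ b₂ b₃ : AExpr D} {i : ID} (h : a₁.id ∉ S) (h₁ : Equiv S a₁ b₁)
      (h₂ : Equiv S a₂ b₂) (h₃ : Equiv S a₃ b₃) : Equiv S (.appC a₁ a₂ a₃ i) (.appC b₁ b₂ b₃ i)
  | appS {a₁ a₂ b₁ b₂ : AExpr D} {i : ID} (h : a₁.id ∉ S) (h₁ : Equiv S a₁ b₁)
      (h₂ : Equiv S a₂ b₂) : Equiv S (.appS a₁ a₂ i) (.appS b₁ b₂ i)
  | app_mem {a a₁ a₂ b b₁ b₂ : AExpr D} {i : ID} (h : a₁.id ∈ S) (ha : a.IsApp a₁ a₂ i)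
      (hb : b.IsApp b₁ b₂ i) (h₁ : Equiv S a₁ b₁) (h₂ : Equiv S a₂ b₂) : Equiv S a b
  | dist_notMem {d : D} {ρ : List (Name × Var)} {a a' b b' : AExpr D} {ev : VExpr} {i : ID}
      (h : i.choice ∉ S) (h₁ : Equiv S a b) (h₂ : Equiv S a' b') :
      Equiv S (.dist d ρ a ev a' i) (.dist d ρ b ev b' i)
  | dist_mem {d : D} {ρ : List (Name × Var)} {a a' b b' : AExpr D} {ev ev' : VExpr} {i : ID}
      (h : i.choice ∈ S) (h₁ : Equiv S a b) :
      Equiv S (.dist d ρ a ev a' i) (.dist d ρ b ev' b' i)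

/-- `S ⊢ t ≡ t'`: the traces differ at most in the parts selected by `S`. -/
inductive Trace.Equiv (S : Set ID) : Trace D → Trace D → Prop
  | nil : Equiv S [] []
  | assume {x : Var} {a b : AExpr D} {t t' : Trace D} (h : a.Equiv S b) (ht : Equiv S t t') :
      Equiv S (.assume x a :: t) (.assume x b :: t')
  | observe {d : D} {a b : AExpr D} {ev : VExpr} {c : ID} {t t' : Trace D} (h : a.Equiv S b)
      (ht : Equiv S t t') : Equiv S (.observe d a ev c :: t) (.observe d b ev c :: t')

open Classical in
/-- Extraction from an augmented expression: the statements produced, and the expression left.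
Stochastic choices outside `S` become observations; an application whose function is outside `S` is
replaced by its body, preceded by assignments of the function and the argument. -/
noncomputable def AExpr.extract (S : Set ID) : AExpr D → Trace D × AExpr D
  | .var x v i => ([], .var x v i)
  | .lam x b v i => ([], .lam x b v i)
  | .appS a₁ a₂ i =>
      ((a₁.extract S).1 ++ (a₂.extract S).1, .appS (a₁.extract S).2 (a₂.extract S).2 i)
  | .appC a₁ a₂ a₃ i =>
      if a₁.id ∈ S then
        ((a₁.extract S).1 ++ (a₂.extract S).1, .appC (a₁.extract S).2 (a₂.extract S).2 a₃ i)
      else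
        ((a₁.extract S).1 ++ [.assume (.fn i) (a₁.extract S).2] ++
          (a₂.extract S).1 ++ [.assume (.arg i) (a₂.extract S).2] ++ (a₃.extract S).1,
          (a₃.extract S).2)
  | .dist d ρ a ev a' i =>
      if i.choice ∈ S then
        ((a.extract S).1, .dist d ρ (a.extract S).2 ev a' i)
      else
        ((a.extract S).1 ++ [.observe d (a.extract S).2 ev i.choice] ++ (a'.extract S).1,
          (a'.extract S).2)

noncomputable def AStmt.extract (S : Set ID) : AStmt D → Trace D
  | .assume x a => (a.extract S).1 ++ [.assume x (a.extract S).2]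
  | .observe d a ev c => (a.extract S).1 ++ [.observe d (a.extract S).2 ev c]

/-- `ExtractTrace(t, S)`. -/
noncomputable def Trace.extract (t : Trace D) (S : Set ID) : Trace D :=
  t.flatMap (AStmt.extract S)

/-! ## Probability of traces -/

/-- Unnormalized density of an augmented expression. -/
noncomputable def AExpr.pdf (𝒟 : Dists D) : AExpr D → ℝ≥0∞
  | .var _ _ _ => 1
  | .lam _ _ _ _ => 1
  | .appC a₁ a₂ a₃ _ => a₁.pdf 𝒟 * a₂.pdf 𝒟 * a₃.pdf 𝒟
  | .appS a₁ a₂ _ => a₁.pdf 𝒟 * a₂.pdf 𝒟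
  | .dist d _ a ev a' _ => a.pdf 𝒟 * a'.pdf 𝒟 * 𝒟.pmf d a.val ev

noncomputable def AStmt.pdf (𝒟 : Dists D) : AStmt D → ℝ≥0∞
  | .assume _ a => a.pdf 𝒟
  | .observe d a ev _ => 𝒟.pmf d a.val ev * a.pdf 𝒟

/-- Unnormalized density of a trace. -/
noncomputable def Trace.pdf (𝒟 : Dists D) (t : Trace D) : ℝ≥0∞ := (t.map (AStmt.pdf 𝒟)).prod

/-- The distribution `μ_P(A) = (∑_{t ∈ A} pdf t) / (∑_t pdf t)` of a program. -/
noncomputable def traceMeasure (𝒟 : Dists D) (P : LProg D) : Measure (TraceSpace 𝒟 P) :=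
  (∑' t : TraceSpace 𝒟 P, Trace.pdf 𝒟 t.1)⁻¹ •
    Measure.sum (fun t : TraceSpace 𝒟 P => Trace.pdf 𝒟 t.1 • Measure.dirac t)

/-! ## Reversible strategies and their equivalence classes -/

/-- A strategy `SS` is reversible if `SS ⊢ t_i ≡ t_{i+1}` along a finite sequence of valid traces
implies `SS ⊢ t_n ≡ t_1`. -/
def Reversible {𝒟 : Dists D} {P : LProg D} (SS : TraceSpace 𝒟 P → Set ID) : Prop :=
  ∀ (n : ℕ) (t : Fin (n + 1) → TraceSpace 𝒟 P),
    (∀ i : Fin n, Trace.Equiv (SS (t i.castSucc)) (t i.castSucc).1 (t i.succ).1) →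
      Trace.Equiv (SS (t (Fin.last n))) (t (Fin.last n)).1 (t 0).1

/-- A reversible strategy divides the trace space into equivalence classes: those of
`SS ⊢ t ≡ t'`. -/
def Reversible.setoid {𝒟 : Dists D} {P : LProg D} {SS : TraceSpace 𝒟 P → Set ID}
    (h : Reversible SS) : Setoid (TraceSpace 𝒟 P) where
  r t t' := Trace.Equiv (SS t) t.1 t'.1
  iseqv := by
    have symm : ∀ {t t' : TraceSpace 𝒟 P}, Trace.Equiv (SS t) t.1 t'.1 →
        Trace.Equiv (SS t') t'.1 t.1 := by
      intro t t' htt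
      refine h 1 ![t, t'] ?_
      intro i
      fin_cases i
      exact htt
    refine ⟨fun t => h 0 ![t] (fun i => i.elim0), symm, ?_⟩
    intro t₁ t₂ t₃ h₁₂ h₂₃
    refine symm (h 2 ![t₁, t₂, t₃] ?_)
    intro i
    fin_cases i
    · exact h₁₂
    · exact h₂₃

/-- The partition `T_c` of the trace space that belongs to the equivalence class `c`. -/
def Reversible.part {𝒟 : Dists D} {P : LProg D} {SS : TraceSpace 𝒟 P → Set ID}
    (h : Reversible SS) (c : Quotient h.setoid) : Set (TraceSpace 𝒟 P) :=
  {t | Quotient.mk h.setoid t = c}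

/-- The conditional distribution `v(c, A) = μ_P(A) / μ_P(T_c)` on a set `T_c` of traces. -/
noncomputable def condMeasure {𝒟 : Dists D} {P : LProg D} (Tc : Set (TraceSpace 𝒟 P)) :
    Measure Tc :=
  (traceMeasure 𝒟 P Tc)⁻¹ • (traceMeasure 𝒟 P).comap Subtype.val

/-! ## Markov kernels -/

/-- `π`-irreducibility: every set of positive measure is reached from every point with positive
probability after some number `n ≥ 1` of steps. -/
def IsIrreducible {T : Type*} [MeasurableSpace T] (π : Measure T) (K : Kernel T T) : Prop :=
  ∀ t : T, ∀ A : Set T, MeasurableSet A → 0 < π A → ∃ n : ℕ, 1 ≤ n ∧ 0 < (K ^ n) t A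

/-- Periodicity: the space splits, up to a null set `N`, into `d ≥ 2` nonempty sets that the kernel
permutes cyclically. -/
def IsPeriodic {T : Type*} [MeasurableSpace T] (π : Measure T) (K : Kernel T T) : Prop :=
  ∃ (d : ℕ) (E : Fin d → Set T) (N : Set T), 2 ≤ d ∧
    (∀ i, MeasurableSet (E i) ∧ (E i).Nonempty) ∧ MeasurableSet N ∧
    (∀ i j, i ≠ j → Disjoint (E i) (E j)) ∧ (∀ i, Disjoint (E i) N) ∧
    (⋃ i, E i) ∪ N = Set.univ ∧ π N = 0 ∧
    ∀ i j : Fin d, (j : ℕ) = (i + 1) % d → ∀ t ∈ E i, K t (E j) = 1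

def IsAperiodic {T : Type*} [MeasurableSpace T] (π : Measure T) (K : Kernel T T) : Prop :=
  ¬ IsPeriodic π K

end ProbLang

namespace ProbLang

variable {D : Type u} {𝒟 : Dists D}

/-! Extraction, each trace `t` being cut along its own subproblem `SS t`, is a density-preserving
bijection from the class onto the traces of the subprogram (`extractEquiv`). All sets on both sides
are measurable, so it is an isomorphism of measurable spaces. The total density of the class equals
that of the subprogram, hence the conditional distribution corresponds to the distribution of the
subprogram (`condMeasure_apply`). The required kernel is `K` conjugated by this isomorphism, and
irreducibility, aperiodicity and invariance are carried along.

Density: a draw outside the subproblem `S` becomes an observation with the same factor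
(`AExpr.pdf_extract`).

Validity (`Eval.extract_spec`): extraction flattens scopes. The body of a closure ran in the
captured environment and must now run in the single growing environment of the subprogram. This is
harmless for a closure produced outside `S`, because its captured environment is the restriction of
the flat one to its free variables (`Good`). Two facts keep this true: fresh names and the variable
convention prevent any visible variable from being rebound, and data edges leaving `S` end only at
samples, so a closure obtained at a node outside `S` never comes from a node inside.

Surjectivity (`Exec.stitch`): a trace `u` of the subprogram is rebuilt into a full trace along a
template `t₀` of the class. At an application whose function lies outside `S`, the new run must meet
the same lambda expression as `t₀`; this is the relation `Val.Sim`. The result `t` is equivalent to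
`t₀`, hence in the class, and extraction along `SS t₀` gives `u`. Extraction along `SS t` gives the
same, because both extracted programs equal `ps` and the program shows which parts were extracted
(`Trace.extract_eq_of_program_eq`).

Injectivity (`Exec.eq_of_extract_eq`): two equivalent traces with the same extract are compared from
the last statement backwards. The identifier of the remaining expression tells at each step whether
something was extracted there. -/

/-! ## Positions -/

/-- The position in the execution as a list, innermost step first. -/
def ID.path : ID → List ℕ
  | .stmt k => [k + 4]
  | .left i => 0 :: i.path
  | .right i => 1 :: i.path
  | .body i => 2 :: i.path
  | .choice i => 3 :: i.path

/-- `k` is `i` or lies below `i`. -/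
def ID.Under (i k : ID) : Prop := i.path <:+ k.path

theorem ID.under_refl (i : ID) : i.Under i := List.suffix_refl _

theorem ID.under_of_left {i k : ID} (h : i.left.Under k) : i.Under k :=
  (List.suffix_cons _ _).trans h

theorem ID.under_of_right {i k : ID} (h : i.right.Under k) : i.Under k :=
  (List.suffix_cons _ _).trans h

theorem ID.under_of_body {i k : ID} (h : i.body.Under k) : i.Under k :=
  (List.suffix_cons _ _).trans h

/-- Two suffixes of one list are nested, so equal length forces equality. The disjointness of the
subtrees at `left`, `right` and `body`, and of those of different statements, follows. -/
theorem ID.Under.path_eq {i j k : ID} (hi : i.Under k) (hj : j.Under k)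
    (hl : i.path.length = j.path.length) : i.path = j.path :=
  (List.suffix_of_suffix_length_le hi hj hl.le).eq_of_length hl

theorem ID.Under.length_le {i k : ID} (h : i.Under k) : i.path.length ≤ k.path.length :=
  List.IsSuffix.length_le h

theorem ID.not_right_of_left {i k : ID} (h : i.left.Under k) : ¬ i.right.Under k := fun h' => by
  simpa [ID.path] using h.path_eq h' (by simp [ID.path])

theorem ID.not_body_of_left {i k : ID} (h : i.left.Under k) : ¬ i.body.Under k := fun h' => by
  simpa [ID.path] using h.path_eq h' (by simp [ID.path])

theorem ID.not_body_of_right {i k : ID} (h : i.right.Under k) : ¬ i.body.Under k := fun h' => by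
  simpa [ID.path] using h.path_eq h' (by simp [ID.path])

theorem ID.not_left_self {i : ID} : ¬ i.left.Under i := fun h => by
  have := h.length_le; simp [ID.path] at this

theorem ID.not_right_self {i : ID} : ¬ i.right.Under i := fun h => by
  have := h.length_le; simp [ID.path] at this

theorem ID.not_body_self {i : ID} : ¬ i.body.Under i := fun h => by
  have := h.length_le; simp [ID.path] at this

theorem ID.stmt_eq_of_under {k l : ℕ} {i : ID} (hk : (ID.stmt k).Under i)
    (hl : (ID.stmt l).Under i) : k = l := by
  simpa [ID.path] using hk.path_eq hl (by simp [ID.path])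

/-! ## Environments -/

theorem Env.restrict_cons_of_mem {σ : Env D} {X : Set Var} {x : Var} {v : Val D} (h : x ∈ X) :
    Env.restrict ((x, v) :: σ) X = (x, v) :: Env.restrict σ X := by
  simp [Env.restrict, h]

theorem Env.restrict_cons_of_notMem {σ : Env D} {X : Set Var} {x : Var} {v : Val D} (h : x ∉ X) :
    Env.restrict ((x, v) :: σ) X = Env.restrict σ X := by
  simp [Env.restrict, h]

theorem Env.get_restrict (σ : Env D) {X : Set Var} {x : Var} (hx : x ∈ X) :
    (σ.restrict X).get x = σ.get x := by
  induction σ with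
  | nil => rfl
  | cons q σ ih =>
    obtain ⟨y, v⟩ := q
    by_cases hy : y ∈ X
    · rw [Env.restrict_cons_of_mem hy]; simp [Env.get, ih]
    · rw [Env.restrict_cons_of_notMem hy, ih, Env.get, if_neg]
      rintro rfl; exact hy hx

theorem Env.restrict_restrict (σ : Env D) {X Y : Set Var} (h : X ⊆ Y) :
    (σ.restrict Y).restrict X = σ.restrict X := by
  simp only [Env.restrict, List.filter_filter]
  refine List.filter_congr fun q _ => ?_
  by_cases hq : q.1 ∈ X
  · simp [hq, h hq]
  · simp [hq]

theorem Env.restrict_eq_mono {σ τ : Env D} {X Y : Set Var} (h : X ⊆ Y)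
    (e : σ.restrict Y = τ.restrict Y) : σ.restrict X = τ.restrict X := by
  rw [← Env.restrict_restrict σ h, e, Env.restrict_restrict τ h]

theorem Env.get_eq_of_restrict_eq {σ τ : Env D} {X : Set Var} {x : Var} (hx : x ∈ X)
    (e : σ.restrict X = τ.restrict X) : σ.get x = τ.get x := by
  rw [← Env.get_restrict σ hx, e, Env.get_restrict τ hx]

theorem Env.restrict_insert_of_unbound {σ : Env D} {X : Set Var} {x : Var}
    (hx : ∀ v, (x, v) ∉ σ) : σ.restrict (insert x X) = σ.restrict X := by
  refine List.filter_congr fun q hq => ?_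
  have : q.1 ≠ x := by rintro rfl; exact hx q.2 hq
  simp [this]

/-! ## Free variables of renamed expressions -/

theorem renameVar_append (ρ : List (Name × Var)) (y : Name) (z : Var) (x : Name) :
    renameVar (ρ ++ [(y, z)]) x = if renameVar ρ x = .src y then z else renameVar ρ x := by
  simp only [renameVar, List.foldl_append]
  rfl

/-- Only an inclusion: the renaming does not avoid capture, so a binder may swallow a source name
`z`. -/
theorem Expr.fv_subst_subset_image (y : Name) (z : Var) (e : Expr D) :
    (e.subst y z).fv 𝒟 ⊆ (fun w => if w = Var.src y then z else w) '' e.fv 𝒟 := by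
  induction e with
  | var w =>
    by_cases h : w = .src y <;> simp [Expr.subst, Expr.fv, h]
  | lam x b ih =>
    by_cases h : x = y
    · subst h
      simp only [Expr.subst, if_true]
      intro w hw
      refine ⟨w, hw, ?_⟩
      have : w ≠ .src x := hw.2
      simp [this]
    · simp only [Expr.subst, if_neg h]
      rintro w ⟨hw, hwx⟩
      obtain ⟨w', hw', rfl⟩ := ih hw
      refine ⟨w', ⟨hw', ?_⟩, rfl⟩
      rintro rfl
      apply hwx
      simp [h]
  | app e₁ e₂ ih₁ ih₂ =>
    simp only [Expr.subst, Expr.fv, Set.image_union]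
    exact Set.union_subset_union ih₁ ih₂
  | dist d ρ e ih =>
    simp only [Expr.subst, Expr.fv, Set.image_union]
    refine Set.union_subset_union ih ?_
    rintro _ ⟨x, hx, rfl⟩
    exact ⟨_, ⟨x, hx, rfl⟩, (renameVar_append ρ y z x).symm⟩

theorem Expr.fv_subst_subset (y : Name) (z : Var) (b : Expr D) :
    (b.subst y z).fv 𝒟 ⊆ insert z ((Expr.lam y b).fv 𝒟) := by
  intro w hw
  obtain ⟨w', hw', rfl⟩ := Expr.fv_subst_subset_image y z b hw
  by_cases h : w' = .src y
  · simp [h]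
  · simp only [if_neg h]
    exact Or.inr ⟨hw', h⟩

theorem Expr.fv_rename_subset (ρ : List (Name × Var)) (e : Expr D) :
    (e.rename ρ).fv 𝒟 ⊆
      (fun w => ρ.foldl (fun w q => if w = Var.src q.1 then q.2 else w) w) '' e.fv 𝒟 := by
  induction ρ generalizing e with
  | nil => simp [Expr.rename]
  | cons q ρ ih =>
    intro w hw
    obtain ⟨w', hw', rfl⟩ := ih (e.subst q.1 q.2) hw
    obtain ⟨w'', hw'', rfl⟩ := Expr.fv_subst_subset_image q.1 q.2 e hw'
    exact ⟨w'', hw'', rfl⟩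

theorem VExpr.fv_toExpr (e : VExpr) : (e.toExpr : Expr D).fv 𝒟 ⊆ Var.src '' e.fv := by
  induction e with
  | var x => simp [VExpr.toExpr, Expr.fv, VExpr.fv]
  | lam x b ih =>
    rintro w ⟨hw, hwx⟩
    obtain ⟨n, hn, rfl⟩ := ih hw
    exact ⟨n, ⟨hn, fun h => hwx (congrArg Var.src h)⟩, rfl⟩
  | app e₁ e₂ ih₁ ih₂ =>
    simp only [VExpr.toExpr, Expr.fv, VExpr.fv, Set.image_union]
    exact Set.union_subset_union ih₁ ih₂

/-- This is the purpose of counting the outcomes among the free variables of a distribution: an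
environment that is correct on these also evaluates every draw correctly. -/
theorem Expr.fv_draw_subset {d : D} {ρ : List (Name × Var)} {e : Expr D} {v : Val D} {ev : VExpr}
    (hev : ev ∈ 𝒟.outcomes d v) :
    ((ev.toExpr : Expr D).rename ρ).fv 𝒟 ⊆ (Expr.dist d ρ e).fv 𝒟 := by
  intro w hw
  obtain ⟨w', hw', rfl⟩ := Expr.fv_rename_subset ρ _ hw
  obtain ⟨n, hn, rfl⟩ := VExpr.fv_toExpr ev hw'
  exact Or.inr ⟨n, ⟨v, ev, hev, hn⟩, rfl⟩

theorem Expr.fv_subset_range_src {e : Expr D} (h : e.IsSource) : e.fv 𝒟 ⊆ Set.range Var.src := by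
  induction e with
  | var x => obtain ⟨n, rfl⟩ := h; simp [Expr.fv]
  | lam x b ih => exact Set.sdiff_subset.trans (ih h)
  | app e₁ e₂ ih₁ ih₂ => exact Set.union_subset (ih₁ h.1) (ih₂ h.2)
  | dist d ρ e ih =>
    obtain ⟨rfl, h⟩ := h
    refine Set.union_subset (ih h) ?_
    rintro _ ⟨n, -, rfl⟩
    exact ⟨n, rfl⟩

/-- Evaluation depends only on the values of the free variables. -/
theorem Eval.congr {σ τ : Env D} {e : LExpr D} {a : AExpr D} (h : Eval 𝒟 σ e a) {E : Expr D}
    {i : ID} (he : e = E.label i) (hτ : σ.restrict (E.fv 𝒟) = τ.restrict (E.fv 𝒟)) :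
    Eval 𝒟 τ e a := by
  induction h generalizing τ E i with
  | free h =>
    cases E <;> simp only [Expr.label, reduceCtorEq, LExpr.var.injEq] at he
    obtain ⟨rfl, rfl⟩ := he
    exact .free (by rw [← Env.get_eq_of_restrict_eq (by simp [Expr.fv]) hτ, h])
  | bound h =>
    cases E <;> simp only [Expr.label, reduceCtorEq, LExpr.var.injEq] at he
    obtain ⟨rfl, rfl⟩ := he
    exact .bound (by rw [← Env.get_eq_of_restrict_eq (by simp [Expr.fv]) hτ, h])
  | lam =>
    cases E <;> simp only [Expr.label, reduceCtorEq, LExpr.lam.injEq] at he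
    obtain ⟨rfl, rfl, rfl⟩ := he
    -- The closure stores the restricted list itself, which is why agreement of environments is
    -- equality of restricted lists and not of lookups.
    rw [hτ]
    exact .lam
  | appC _ _ hv h₃ ih₁ ih₂ _ =>
    cases E <;> simp only [Expr.label, reduceCtorEq, LExpr.app.injEq] at he
    obtain ⟨he₁, he₂, rfl⟩ := he
    -- The body runs in the environment of the closure, so its evaluation is reused unchanged.
    exact .appC (ih₁ he₁ (Env.restrict_eq_mono Set.subset_union_left hτ))
      (ih₂ he₂ (Env.restrict_eq_mono Set.subset_union_right hτ)) hv h₃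
  | appS _ _ hv ih₁ ih₂ =>
    cases E <;> simp only [Expr.label, reduceCtorEq, LExpr.app.injEq] at he
    obtain ⟨he₁, he₂, rfl⟩ := he
    exact .appS (ih₁ he₁ (Env.restrict_eq_mono Set.subset_union_left hτ))
      (ih₂ he₂ (Env.restrict_eq_mono Set.subset_union_right hτ)) hv
  | dist _ hev _ ih ih' =>
    cases E <;> simp only [Expr.label, reduceCtorEq, LExpr.dist.injEq] at he
    obtain ⟨rfl, rfl, he, rfl⟩ := he
    exact .dist (ih he (Env.restrict_eq_mono Set.subset_union_left hτ)) hev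
      (ih' rfl (Env.restrict_eq_mono (Expr.fv_draw_subset hev) hτ))

/-! ## Identifiers in augmented expressions -/

/-- The identifiers in `a` are those of an evaluation at `i`. -/
def AExpr.Labeled : ID → AExpr D → Prop
  | i, .var _ _ j => j = i
  | i, .lam _ _ _ j => j = i
  | i, .appC a₁ a₂ a₃ j => j = i ∧ a₁.Labeled i.left ∧ a₂.Labeled i.right ∧ a₃.Labeled i.body
  | i, .appS a₁ a₂ j => j = i ∧ a₁.Labeled i.left ∧ a₂.Labeled i.right
  | i, .dist _ _ a _ a' j => j = i ∧ a.Labeled i.left ∧ a'.Labeled i.body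

theorem Eval.labeled {σ : Env D} {e : LExpr D} {a : AExpr D} (h : Eval 𝒟 σ e a) {E : Expr D}
    {i : ID} (he : e = E.label i) : a.Labeled i := by
  induction h generalizing E i with
  | free h => cases E <;> simp_all [Expr.label, AExpr.Labeled]
  | bound h => cases E <;> simp_all [Expr.label, AExpr.Labeled]
  | lam => cases E <;> simp_all [Expr.label, AExpr.Labeled]
  | appC _ _ _ _ ih₁ ih₂ ih₃ =>
    cases E <;> simp only [Expr.label, reduceCtorEq, LExpr.app.injEq] at he
    obtain ⟨he₁, he₂, rfl⟩ := he
    exact ⟨rfl, ih₁ he₁, ih₂ he₂, ih₃ rfl⟩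
  | appS _ _ _ ih₁ ih₂ =>
    cases E <;> simp only [Expr.label, reduceCtorEq, LExpr.app.injEq] at he
    obtain ⟨he₁, he₂, rfl⟩ := he
    exact ⟨rfl, ih₁ he₁, ih₂ he₂⟩
  | dist _ _ _ ih ih' =>
    cases E <;> simp only [Expr.label, reduceCtorEq, LExpr.dist.injEq] at he
    obtain ⟨rfl, rfl, he, rfl⟩ := he
    exact ⟨rfl, ih he, ih' rfl⟩

-- What replaces an extracted application or draw is the evaluated body or the evaluated draw, from
-- which the value was taken anyway.
@[simp] theorem AExpr.extract_val (S : Set ID) (a : AExpr D) : (a.extract S).2.val = a.val := by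
  induction a with
  | var | lam => rfl
  | appC a₁ a₂ a₃ i ih₁ ih₂ ih₃ =>
    simp only [AExpr.extract]; split_ifs <;> simp [AExpr.val, ih₃]
  | appS a₁ a₂ i ih₁ ih₂ => simp [AExpr.extract, AExpr.val, ih₁, ih₂]
  | dist d ρ a ev a' i ih ih' =>
    simp only [AExpr.extract]; split_ifs <;> simp [AExpr.val, ih']

/-! ## Execution of consecutive programs -/

/-- The environment after the statements of a trace. -/
def Trace.bind : Env D → Trace D → Env D
  | τ, [] => τ
  | τ, .assume x a :: t => Trace.bind ((x, a.val) :: τ) t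
  | τ, .observe _ _ _ _ :: t => Trace.bind τ t

@[simp] theorem Trace.bind_nil (τ : Env D) : Trace.bind τ [] = τ := rfl

@[simp] theorem Trace.bind_append (τ : Env D) (t u : Trace D) :
    Trace.bind τ (t ++ u) = Trace.bind (Trace.bind τ t) u := by
  induction t generalizing τ with
  | nil => rfl
  | cons s t ih => cases s <;> exact ih _

@[simp] theorem Trace.bind_assume (τ : Env D) (x : Var) (a : AExpr D) (t : Trace D) :
    Trace.bind τ (.assume x a :: t) = Trace.bind ((x, a.val) :: τ) t := rfl

@[simp] theorem Trace.bind_observe (τ : Env D) (d : D) (a : AExpr D) (ev : VExpr) (c : ID)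
    (t : Trace D) : Trace.bind τ (.observe d a ev c :: t) = Trace.bind τ t := rfl

@[simp] theorem Trace.program_nil : Trace.program ([] : Trace D) = [] := rfl

@[simp] theorem Trace.program_append (t u : Trace D) :
    Trace.program (t ++ u) = Trace.program t ++ Trace.program u := List.map_append

@[simp] theorem Trace.program_cons (s : AStmt D) (t : Trace D) :
    Trace.program (s :: t) = s.roll :: Trace.program t := rfl

theorem Exec.append {τ : Env D} {P Q : LProg D} {t u : Trace D} (ht : Exec 𝒟 τ P t)
    (hu : Exec 𝒟 (Trace.bind τ t) Q u) : Exec 𝒟 τ (P ++ Q) (t ++ u) := by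
  induction ht with
  | nil => exact hu
  | assume h _ ih => exact .assume h (ih hu)
  | observe h hev _ ih => exact .observe h hev (ih hu)

theorem Exec.split {τ : Env D} {P Q : LProg D} {t : Trace D} (h : Exec 𝒟 τ (P ++ Q) t) :
    ∃ t₁ t₂, t = t₁ ++ t₂ ∧ Exec 𝒟 τ P t₁ ∧ Exec 𝒟 (Trace.bind τ t₁) Q t₂ := by
  induction P generalizing τ t with
  | nil => exact ⟨[], t, rfl, .nil, h⟩
  | cons s P ih =>
    cases h with
    | assume h ht =>
      obtain ⟨t₁, t₂, rfl, h₁, h₂⟩ := ih ht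
      exact ⟨_ :: t₁, t₂, rfl, .assume h h₁, h₂⟩
    | observe h hev ht =>
      obtain ⟨t₁, t₂, rfl, h₁, h₂⟩ := ih ht
      exact ⟨_ :: t₁, t₂, rfl, .observe h hev h₁, h₂⟩

theorem Eval.roll_eq {σ : Env D} {e : LExpr D} {a : AExpr D} (h : Eval 𝒟 σ e a) : a.roll = e := by
  induction h <;> simp_all [AExpr.roll]

theorem Exec.program_eq {τ : Env D} {P : LProg D} {t : Trace D} (h : Exec 𝒟 τ P t) :
    Trace.program t = P := by
  induction h with
  | nil => rfl
  | assume h _ ih => simp [AStmt.roll, h.roll_eq, ih]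
  | observe h _ _ ih => simp [AStmt.roll, h.roll_eq, ih]

/-- The variables assigned by a program. -/
def LProg.bound (P : LProg D) : Set Var := {x | ∃ e, LStmt.assume x e ∈ P}

/-- Source of all freshness arguments: the introduced names are indexed by positions in the subtree
of `i`. It concerns the program only, so it applies to every execution of the extracted statements.
-/
theorem AExpr.Labeled.bound_extract {i : ID} {a : AExpr D} (h : a.Labeled i) (S : Set ID)
    {x : Var} (hx : x ∈ LProg.bound (Trace.program (a.extract S).1)) :
    ∃ k, i.Under k ∧ (x = .fn k ∨ x = .arg k) := by
  obtain ⟨e, he⟩ := hx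
  induction a generalizing i with
  | var | lam => simp [AExpr.extract] at he
  | appC a₁ a₂ a₃ j ih₁ ih₂ ih₃ =>
    obtain ⟨rfl, h₁, h₂, h₃⟩ := h
    simp only [AExpr.extract] at he
    split_ifs at he
    · simp only [Trace.program_append, List.mem_append] at he
      rcases he with he | he
      · obtain ⟨k, hk, hx⟩ := ih₁ h₁ he
        exact ⟨k, ID.under_of_left hk, hx⟩
      · obtain ⟨k, hk, hx⟩ := ih₂ h₂ he
        exact ⟨k, ID.under_of_right hk, hx⟩
    · simp only [Trace.program_append, List.mem_append, Trace.program_cons, Trace.program_nil,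
        AStmt.roll, List.mem_singleton, LStmt.assume.injEq] at he
      rcases he with (((he | he) | he) | he) | he
      · obtain ⟨k, hk, hx⟩ := ih₁ h₁ he
        exact ⟨k, ID.under_of_left hk, hx⟩
      · exact ⟨j, j.under_refl, .inl he.1⟩
      · obtain ⟨k, hk, hx⟩ := ih₂ h₂ he
        exact ⟨k, ID.under_of_right hk, hx⟩
      · exact ⟨j, j.under_refl, .inr he.1⟩
      · obtain ⟨k, hk, hx⟩ := ih₃ h₃ he
        exact ⟨k, ID.under_of_body hk, hx⟩
  | appS a₁ a₂ j ih₁ ih₂ =>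
    obtain ⟨rfl, h₁, h₂⟩ := h
    simp only [AExpr.extract, Trace.program_append, List.mem_append] at he
    rcases he with he | he
    · obtain ⟨k, hk, hx⟩ := ih₁ h₁ he
      exact ⟨k, ID.under_of_left hk, hx⟩
    · obtain ⟨k, hk, hx⟩ := ih₂ h₂ he
      exact ⟨k, ID.under_of_right hk, hx⟩
  | dist d ρ a ev a' j ih ih' =>
    obtain ⟨rfl, h, h'⟩ := h
    simp only [AExpr.extract] at he
    split_ifs at he
    · obtain ⟨k, hk, hx⟩ := ih h he
      exact ⟨k, ID.under_of_left hk, hx⟩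
    · simp only [Trace.program_append, List.mem_append, Trace.program_cons, Trace.program_nil,
        AStmt.roll, List.mem_singleton, reduceCtorEq, or_false] at he
      rcases he with he | he
      · obtain ⟨k, hk, hx⟩ := ih h he
        exact ⟨k, ID.under_of_left hk, hx⟩
      · obtain ⟨k, hk, hx⟩ := ih' h' he
        exact ⟨k, ID.under_of_body hk, hx⟩

end ProbLang

namespace ProbLang

variable {D : Type u} {𝒟 : Dists D} {S : Set ID} {β : Set (Var × ID)} {R R' : Set Name}

/-! ## Scoping invariants of extracted traces -/

/-- Variables that an expression may mention when it is evaluated in `τ`: bound arguments, and names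
that are not assigned later. -/
def Vis (R : Set Name) (τ : Env D) : Set Var :=
  {x | (∃ n, x = .src n ∧ n ∉ R) ∨ ∃ k v, x = .arg k ∧ (x, v) ∈ τ}

/-- The variable `fn k` is never read; its assignment only keeps the evaluation of the function in
the subprogram. Such bindings may therefore be ignored in all invariants. -/
theorem Vis.fn_notMem {τ : Env D} {k : ID} : Var.fn k ∉ Vis R τ := by
  simp [Vis]

theorem Vis.src_mem {τ : Env D} {n : Name} : Var.src n ∈ Vis R τ ↔ n ∉ R := by
  simp [Vis]

theorem Vis.arg_mem {τ : Env D} {k : ID} : Var.arg k ∈ Vis R τ ↔ ∃ v, (Var.arg k, v) ∈ τ := by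
  simp [Vis]

/-- All that is visible in `τ` remains so in `τ'`, with the same values. -/
structure ScopeLE (R : Set Name) (τ : Env D) (R' : Set Name) (τ' : Env D) : Prop where
  subset : Vis R τ ⊆ Vis R' τ'
  restrict_eq : τ.restrict (Vis R τ) = τ'.restrict (Vis R τ)

theorem ScopeLE.refl (R : Set Name) (τ : Env D) : ScopeLE R τ R τ := ⟨subset_rfl, rfl⟩

theorem ScopeLE.trans {R₁ R₂ R₃ : Set Name} {τ₁ τ₂ τ₃ : Env D} (h : ScopeLE R₁ τ₁ R₂ τ₂)
    (h' : ScopeLE R₂ τ₂ R₃ τ₃) : ScopeLE R₁ τ₁ R₃ τ₃ :=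
  ⟨h.subset.trans h'.subset,
    h.restrict_eq.trans (Env.restrict_eq_mono h.subset h'.restrict_eq)⟩

/-- A binding of an invisible variable shadows nothing visible; shrinking `R` records that a name
has now been assigned. -/
theorem ScopeLE.cons {τ : Env D} {x : Var} (v : Val D) (hR : R' ⊆ R) (hx : x ∉ Vis R τ) :
    ScopeLE R τ R' ((x, v) :: τ) := by
  refine ⟨?_, (Env.restrict_cons_of_notMem hx).symm⟩
  rintro y (⟨n, rfl, hn⟩ | ⟨k, w, rfl, hk⟩)
  · exact .inl ⟨n, rfl, fun h => hn (hR h)⟩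
  · exact .inr ⟨k, w, rfl, List.mem_cons_of_mem _ hk⟩

/-- A closure is good if its environment is visible in `τ`. -/
def Good (𝒟 : Dists D) (R : Set Name) (τ : Env D) (v : Val D) : Prop :=
  ∀ y b σ, v = .clo y b σ →
    (Expr.lam y b).fv 𝒟 ⊆ Vis R τ ∧ σ = τ.restrict ((Expr.lam y b).fv 𝒟)

theorem Good.mono {τ τ' : Env D} {v : Val D} (h : Good 𝒟 R τ v) (hs : ScopeLE R τ R' τ') :
    Good 𝒟 R' τ' v := fun y b σ hv => by
  obtain ⟨h₁, h₂⟩ := h y b σ hv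
  exact ⟨h₁.trans hs.subset, h₂.trans (Env.restrict_eq_mono h₁ hs.restrict_eq)⟩

/-- Every visible binding of `τ` is recorded in `β`, and is good if it was made outside `S`. -/
def EnvOK (𝒟 : Dists D) (S : Set ID) (β : Set (Var × ID)) (R : Set Name) (τ : Env D) : Prop :=
  ∀ x v, τ.get x = some v → (∀ k, x ≠ .fn k) → ∃ j, (x, j) ∈ β ∧ (j ∉ S → Good 𝒟 R τ v)

theorem EnvOK.cons {τ : Env D} {x : Var} {v : Val D} (h : EnvOK 𝒟 S β R τ)
    (hs : ScopeLE R τ R' ((x, v) :: τ))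
    (hx : (∀ k, x ≠ .fn k) → ∃ j, (x, j) ∈ β ∧ (j ∉ S → Good 𝒟 R τ v)) :
    EnvOK 𝒟 S β R' ((x, v) :: τ) := by
  intro y w hy hfn
  rw [Env.get] at hy
  split_ifs at hy with hxy
  · subst hxy
    obtain rfl := Option.some.inj hy
    obtain ⟨j, hj, hg⟩ := hx hfn
    exact ⟨j, hj, fun hS => (hg hS).mono hs⟩
  · obtain ⟨j, hj, hg⟩ := h y w hy hfn
    exact ⟨j, hj, fun hS => (hg hS).mono hs⟩

/-- No argument of an application at or below `i` is bound. -/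
def Fresh (i : ID) (τ : Env D) : Prop := ∀ k v, (Var.arg k, v) ∈ τ → ¬ i.Under k

/-- `τ'` extends `τ` by bindings that belong to applications in `P`. -/
structure Grows (R : Set Name) (P : Set ID) (τ τ' : Env D) : Prop where
  le : ScopeLE R τ R τ'
  args : ∀ k v, (Var.arg k, v) ∈ τ' → (∃ v', (Var.arg k, v') ∈ τ) ∨ k ∈ P

theorem Grows.trans {P : Set ID} {τ₁ τ₂ τ₃ : Env D} (h : Grows R P τ₁ τ₂) (h' : Grows R P τ₂ τ₃) :
    Grows R P τ₁ τ₃ := by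
  refine ⟨h.le.trans h'.le, fun k v hk => ?_⟩
  rcases h'.args k v hk with ⟨v', hk'⟩ | hk'
  · exact h.args k v' hk'
  · exact .inr hk'

theorem Grows.fresh {P : Set ID} {τ τ' : Env D} {i : ID} (h : Grows R P τ τ') (hf : Fresh i τ)
    (hP : ∀ k ∈ P, ¬ i.Under k) : Fresh i τ' := fun k v hk => by
  rcases h.args k v hk with ⟨v', hk'⟩ | hk'
  · exact hf k v' hk'
  · exact hP k hk'

theorem Grows.fn (k : ID) (v : Val D) (τ : Env D) (P : Set ID) :
    Grows R P τ ((.fn k, v) :: τ) :=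
  ⟨.cons v subset_rfl Vis.fn_notMem, fun k' v' h => .inl ⟨v', by simpa using h⟩⟩

theorem Grows.arg {k : ID} (v : Val D) {τ : Env D} {P : Set ID} (hk : ∀ v, (Var.arg k, v) ∉ τ)
    (hP : k ∈ P) : Grows R P τ ((.arg k, v) :: τ) := by
  refine ⟨.cons v subset_rfl fun h => ?_, fun k' v' h => ?_⟩
  · obtain ⟨v', h⟩ := Vis.arg_mem.1 h
    exact hk v' h
  · rcases List.mem_cons.1 h with h | h
    · simp only [Prod.mk.injEq, Var.arg.injEq] at h
      exact .inr (h.1 ▸ hP)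
    · exact .inl ⟨v', h⟩

theorem Fresh.left {i : ID} {τ : Env D} (h : Fresh i τ) : Fresh i.left τ :=
  fun k v hk hi => h k v hk (ID.under_of_left hi)

theorem Fresh.right {i : ID} {τ : Env D} (h : Fresh i τ) : Fresh i.right τ :=
  fun k v hk hi => h k v hk (ID.under_of_right hi)

theorem Fresh.body {i : ID} {τ : Env D} (h : Fresh i τ) : Fresh i.body τ :=
  fun k v hk hi => h k v hk (ID.under_of_body hi)

theorem Trace.mem_bind {τ : Env D} {u : Trace D} {x : Var} {v : Val D} :
    (x, v) ∈ Trace.bind τ u → (x, v) ∈ τ ∨ x ∈ LProg.bound (Trace.program u) := by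
  induction u generalizing τ with
  | nil => exact .inl
  | cons s u ih =>
    intro h
    cases s with
    | assume y a =>
      rcases ih h with h | ⟨e, he⟩
      · rcases List.mem_cons.1 h with h | h
        · simp only [Prod.mk.injEq] at h
          exact .inr ⟨a.roll, by simp [AStmt.roll, h.1]⟩
        · exact .inl h
      · exact .inr ⟨e, List.mem_cons_of_mem _ he⟩
    | observe d a ev c =>
      rcases ih h with h | ⟨e, he⟩
      · exact .inl h
      · exact .inr ⟨e, List.mem_cons_of_mem _ he⟩

theorem Trace.mem_bind_of_mem {τ : Env D} {u : Trace D} {q : Var × Val D} (h : q ∈ τ) :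
    q ∈ Trace.bind τ u := by
  induction u generalizing τ with
  | nil => exact h
  | cons s u ih =>
    cases s with
    | assume y a => exact ih (List.mem_cons_of_mem _ h)
    | observe d a ev c => exact ih h

theorem Trace.restrict_bind {τ : Env D} {u : Trace D} {X : Set Var}
    (h : ∀ x ∈ LProg.bound (Trace.program u), x ∉ X) :
    (Trace.bind τ u).restrict X = τ.restrict X := by
  induction u generalizing τ with
  | nil => rfl
  | cons s u ih =>
    have hu : ∀ x ∈ LProg.bound (Trace.program u), x ∉ X :=
      fun x ⟨e, he⟩ => h x ⟨e, List.mem_cons_of_mem _ he⟩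
    cases s with
    | assume y a =>
      refine (ih hu).trans (Env.restrict_cons_of_notMem (h y ⟨a.roll, ?_⟩))
      simp [AStmt.roll]
    | observe d a ev c => exact ih hu

/-- The statements extracted from an evaluation at `i` bind only variables that belong to
applications at or below `i`. -/
theorem AExpr.Labeled.grows {i : ID} {a : AExpr D} (h : a.Labeled i) {τ : Env D}
    (hf : Fresh i τ) {u : Trace D} (hu : Trace.program u = Trace.program (a.extract S).1) :
    Grows R {k | i.Under k} τ (Trace.bind τ u) := by
  refine ⟨⟨?_, (Trace.restrict_bind ?_).symm⟩, fun k v hk => ?_⟩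
  · rintro y (⟨n, rfl, hn⟩ | ⟨k, w, rfl, hk⟩)
    · exact .inl ⟨n, rfl, hn⟩
    · exact .inr ⟨k, w, rfl, Trace.mem_bind_of_mem hk⟩
  · intro x hx hV
    obtain ⟨k, hk, rfl | rfl⟩ := h.bound_extract S (hu ▸ hx)
    · exact Vis.fn_notMem hV
    · obtain ⟨v, hv⟩ := Vis.arg_mem.1 hV
      exact hf k v hv hk
  · rcases Trace.mem_bind hk with hk | hk
    · exact .inl ⟨v, hk⟩
    · obtain ⟨k', hk', h | h⟩ := h.bound_extract S (hu ▸ hk)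
      · cases h
      · cases h
        exact .inr hk'

/-- `E` can be evaluated at `i` in the flat environment `τ` instead of `σ`. -/
structure Ready (𝒟 : Dists D) (S : Set ID) (β : Set (Var × ID)) (R : Set Name) (E : Expr D)
    (i : ID) (σ τ : Env D) : Prop where
  agree : σ.restrict (E.fv 𝒟) = τ.restrict (E.fv 𝒟)
  fv_subset : E.fv 𝒟 ⊆ Vis R τ
  ok : EnvOK 𝒟 S β R τ
  fresh : Fresh i τ

theorem Ready.move {E E' : Expr D} {i i' : ID} {σ τ τ' : Env D} (h : Ready 𝒟 S β R E i σ τ)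
    (hE : E'.fv 𝒟 ⊆ E.fv 𝒟) (hs : ScopeLE R τ R τ') (hok : EnvOK 𝒟 S β R τ')
    (hf : Fresh i' τ') : Ready 𝒟 S β R E' i' σ τ' :=
  ⟨Env.restrict_eq_mono hE (h.agree.trans (Env.restrict_eq_mono h.fv_subset hs.restrict_eq)),
    (hE.trans h.fv_subset).trans hs.subset, hok, hf⟩

theorem Ready.agree_of_le {E : Expr D} {i : ID} {σ τ τ' : Env D} (h : Ready 𝒟 S β R E i σ τ)
    (hs : ScopeLE R τ R τ') : σ.restrict (E.fv 𝒟) = τ'.restrict (E.fv 𝒟) :=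
  h.agree.trans (Env.restrict_eq_mono h.fv_subset hs.restrict_eq)

theorem Ready.appLeft {E₁ E₂ : Expr D} {i : ID} {σ τ : Env D}
    (h : Ready 𝒟 S β R (.app E₁ E₂) i σ τ) : Ready 𝒟 S β R E₁ i.left σ τ :=
  h.move Set.subset_union_left (.refl _ _) h.ok h.fresh.left

theorem Ready.distLeft {d : D} {ρ : List (Name × Var)} {E : Expr D} {i : ID} {σ τ : Env D}
    (h : Ready 𝒟 S β R (.dist d ρ E) i σ τ) : Ready 𝒟 S β R E i.left σ τ :=
  h.move Set.subset_union_left (.refl _ _) h.ok h.fresh.left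

theorem Ready.appRight {E₁ E₂ : Expr D} {i : ID} {σ τ τ' : Env D}
    (h : Ready 𝒟 S β R (.app E₁ E₂) i σ τ) (hg : Grows R {k | i.left.Under k} τ τ')
    (hok : EnvOK 𝒟 S β R τ') : Ready 𝒟 S β R E₂ i.right σ τ' :=
  h.move Set.subset_union_right hg.le hok
    (hg.fresh h.fresh.right fun _ hk => ID.not_right_of_left hk)

theorem Ready.draw {d : D} {ρ : List (Name × Var)} {E : Expr D} {i : ID} {σ τ τ' : Env D}
    (h : Ready 𝒟 S β R (.dist d ρ E) i σ τ) (hg : Grows R {k | i.left.Under k} τ τ')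
    (hok : EnvOK 𝒟 S β R τ') {v : Val D} {ev : VExpr} (hev : ev ∈ 𝒟.outcomes d v) :
    Ready 𝒟 S β R (ev.toExpr.rename ρ) i.body σ τ' :=
  h.move (Expr.fv_draw_subset hev) hg.le hok
    (hg.fresh h.fresh.body fun _ hk => ID.not_body_of_left hk)

/-- The body of a good closure can be evaluated in the flat environment, once the argument is
bound. -/
theorem Ready.body {y : Name} {b : Expr D} {i : ID} {σ τ : Env D} {v : Val D}
    (hg : Good 𝒟 R τ (.clo y b σ)) (hi : ∀ v, (Var.arg i, v) ∉ τ)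
    (hok : EnvOK 𝒟 S β R ((.arg i, v) :: τ)) (hf : Fresh i.body τ) :
    Ready 𝒟 S β R (b.subst y (.arg i)) i.body ((.arg i, v) :: σ) ((.arg i, v) :: τ) := by
  obtain ⟨h₁, h₂⟩ := hg y b σ rfl
  refine ⟨Env.restrict_eq_mono (Expr.fv_subst_subset y (.arg i) b) ?_, ?_, hok, ?_⟩
  -- Both environments get the same new binding, and `arg i` is unbound in their tails. What remains
  -- to compare is the captured environment with the restriction of `τ`, equal by goodness.
  · rw [Env.restrict_cons_of_mem (Set.mem_insert _ _), Env.restrict_cons_of_mem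
      (Set.mem_insert _ _), Env.restrict_insert_of_unbound hi, Env.restrict_insert_of_unbound, h₂,
      Env.restrict_restrict _ subset_rfl]
    intro w hw
    rw [h₂] at hw
    exact hi w (List.mem_of_mem_filter hw)
  · refine (Expr.fv_subst_subset y (.arg i) b).trans (Set.insert_subset ?_ ?_)
    · exact Vis.arg_mem.2 ⟨v, List.mem_cons_self⟩
    · refine h₁.trans (Grows.arg (P := {i}) v hi rfl).le.subset
  · exact (Grows.arg (R := R) (P := {i}) v hi rfl).fresh hf fun k hk => by
      rw [hk]; exact ID.not_body_self

/-! ## Closed sets of nodes -/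

/-- The part of the validity of a subproblem `S` that concerns expressions that are extracted. -/
def AExpr.Closed (S : Set ID) (β : Set (Var × ID)) : AExpr D → Prop
  | .var x _ i => ∀ j, (x, j) ∈ β → j ∈ S → i ∈ S
  | .lam _ _ _ _ => True
  | .appC a₁ a₂ a₃ i => (a₁.id ∈ S → i ∈ S) ∧ a₁.Closed S β ∧ a₂.Closed S β ∧
      (a₁.id ∉ S → (a₃.id ∈ S → i ∈ S) ∧ (.arg i, a₂.id) ∈ β ∧ a₃.Closed S β)
  | .appS a₁ a₂ i => (a₁.id ∈ S → i ∈ S) ∧ a₁.Closed S β ∧ a₂.Closed S β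
  | .dist _ _ a _ a' i => (i.choice ∈ S → i ∈ S) ∧ a.Closed S β ∧
      (i.choice ∉ S → (a'.id ∈ S → i ∈ S) ∧ a'.Closed S β)

/-- A data edge may leave `S` only towards a choice. The position of an evaluated expression is
never a choice, so membership in `S` propagates along every data edge into it. -/
theorem AExpr.Labeled.closed {i : ID} {a : AExpr D} (h : a.Labeled i) (hi : ∀ k, i ≠ .choice k)
    (hβ : a.binders ⊆ β)
    (hS : ∀ q ∈ a.dataEdges β, q.1 ∈ S → q.2 ∉ S → ∃ k, q.2 = .choice k) : a.Closed S β := by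
  induction a generalizing i with
  | var x v j =>
    intro k hk hkS
    by_contra hj
    obtain rfl := h
    obtain ⟨k', hk'⟩ := hS (k, j) ⟨hk, rfl⟩ hkS hj
    exact hi k' hk'
  | lam => trivial
  | appC a₁ a₂ a₃ j ih₁ ih₂ ih₃ =>
    obtain ⟨rfl, h₁, h₂, h₃⟩ := h
    simp only [AExpr.binders, Set.union_subset_iff, Set.singleton_subset_iff] at hβ
    obtain ⟨⟨⟨hβ, hβ₁⟩, hβ₂⟩, hβ₃⟩ := hβ
    simp only [AExpr.dataEdges, Set.mem_union, Set.mem_insert_iff, Set.mem_singleton_iff] at hS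
    refine ⟨fun hj => ?_, ih₁ h₁ (by simp) hβ₁ fun q hq => hS q (by tauto),
      ih₂ h₂ (by simp) hβ₂ fun q hq => hS q (by tauto),
      fun _ => ⟨fun hj => ?_, hβ, ih₃ h₃ (by simp) hβ₃ fun q hq => hS q (by tauto)⟩⟩ <;>
    by_contra hn
    · obtain ⟨k, hk⟩ := hS (a₁.id, j) (by simp) hj hn
      exact hi k hk
    · obtain ⟨k, hk⟩ := hS (a₃.id, j) (by simp) hj hn
      exact hi k hk
  | appS a₁ a₂ j ih₁ ih₂ =>
    obtain ⟨rfl, h₁, h₂⟩ := h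
    simp only [AExpr.binders, Set.union_subset_iff] at hβ
    simp only [AExpr.dataEdges, Set.mem_union, Set.mem_insert_iff, Set.mem_singleton_iff] at hS
    refine ⟨fun hj => ?_, ih₁ h₁ (by simp) hβ.1 fun q hq => hS q (by tauto),
      ih₂ h₂ (by simp) hβ.2 fun q hq => hS q (by tauto)⟩
    by_contra hn
    obtain ⟨k, hk⟩ := hS (a₁.id, j) (by simp) hj hn
    exact hi k hk
  | dist d ρ a ev a' j ih ih' =>
    obtain ⟨rfl, h, h'⟩ := h
    simp only [AExpr.binders, Set.union_subset_iff] at hβ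
    simp only [AExpr.dataEdges, Set.mem_union, Set.mem_insert_iff, Set.mem_singleton_iff] at hS
    refine ⟨fun hj => ?_, ih h (by simp) hβ.1 fun q hq => hS q (by tauto),
      fun _ => ⟨fun hj => ?_, ih' h' (by simp) hβ.2 fun q hq => hS q (by tauto)⟩⟩ <;>
    by_contra hn
    · obtain ⟨k, hk⟩ := hS (j.choice, j) (by simp) hj hn
      exact hi k hk
    · obtain ⟨k, hk⟩ := hS (a'.id, j) (by simp) hj hn
      exact hi k hk

theorem AExpr.IsApp.id_eq {a a₁ a₂ : AExpr D} {i : ID} (h : a.IsApp a₁ a₂ i) : a.id = i := by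
  rcases h with rfl | ⟨a₃, rfl⟩ <;> rfl

theorem AExpr.Equiv.id_eq {a b : AExpr D} (h : AExpr.Equiv S a b) : a.id = b.id := by
  cases h with
  | app_mem _ ha hb => rw [ha.id_eq, hb.id_eq]
  | _ => rfl

/-- The condition reads identifiers and variables, never values, and says nothing about the bodies
and draws that the equivalence leaves arbitrary. -/
theorem AExpr.Equiv.closed {a b : AExpr D} (h : AExpr.Equiv S a b) (ha : a.Closed S β) :
    b.Closed S β := by
  induction h with
  | var => exact ha
  | lam => trivial
  | appC h h₁ h₂ h₃ ih₁ ih₂ ih₃ =>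
    obtain ⟨ha, ha₁, ha₂, ha₃⟩ := ha
    obtain ⟨ha₃, ha₄, ha₅⟩ := ha₃ h
    exact ⟨h₁.id_eq ▸ ha, ih₁ ha₁, ih₂ ha₂, fun _ => ⟨h₃.id_eq ▸ ha₃, h₂.id_eq ▸ ha₄, ih₃ ha₅⟩⟩
  | appS h h₁ h₂ ih₁ ih₂ =>
    obtain ⟨ha, ha₁, ha₂⟩ := ha
    exact ⟨h₁.id_eq ▸ ha, ih₁ ha₁, ih₂ ha₂⟩
  | @app_mem a a₁ a₂ b b₁ b₂ i h ha' hb h₁ h₂ ih₁ ih₂ =>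
    have hc : (a₁.id ∈ S → i ∈ S) ∧ a₁.Closed S β ∧ a₂.Closed S β := by
      rcases ha' with rfl | ⟨a₃, rfl⟩
      · exact ha
      · exact ⟨ha.1, ha.2.1, ha.2.2.1⟩
    obtain ⟨hc, hc₁, hc₂⟩ := hc
    rw [h₁.id_eq] at hc h
    rcases hb with rfl | ⟨b₃, rfl⟩
    · exact ⟨hc, ih₁ hc₁, ih₂ hc₂⟩
    · exact ⟨hc, ih₁ hc₁, ih₂ hc₂, fun h' => absurd h h'⟩
  | dist_notMem h h₁ h₂ ih₁ ih₂ =>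
    obtain ⟨ha, ha₁, ha₂⟩ := ha
    exact ⟨ha, ih₁ ha₁, fun _ => ⟨h₂.id_eq ▸ (ha₂ h).1, ih₂ (ha₂ h).2⟩⟩
  | dist_mem h h₁ ih =>
    exact ⟨ha.1, ih ha.2.1, fun h' => absurd h h'⟩

/-! ## Extracted traces are valid -/

/-- The four claims feed each other in one induction. Goodness of values outside `S` allows the body
of an extracted application to run in the flat environment; `EnvOK` preserves goodness through
variables. The remaining expression must evaluate in every later environment `τ'`, since the
statements extracted from an argument come between those of the function and the use of its value.
-/
theorem Eval.extract_spec {σ : Env D} {e : LExpr D} {a : AExpr D} (h : Eval 𝒟 σ e a) {E : Expr D}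
    {i : ID} {τ : Env D} (he : e = E.label i) (hc : a.Closed S β) (hr : Ready 𝒟 S β R E i σ τ) :
    Exec 𝒟 τ (Trace.program (a.extract S).1) (a.extract S).1 ∧
    (∀ τ', ScopeLE R (Trace.bind τ (a.extract S).1) R τ' →
      Eval 𝒟 τ' (a.extract S).2.roll (a.extract S).2) ∧
    EnvOK 𝒟 S β R (Trace.bind τ (a.extract S).1) ∧
    (a.id ∉ S → Good 𝒟 R (Trace.bind τ (a.extract S).1) a.val) := by
  induction h generalizing τ E i with
  | free h =>
    cases E <;> simp only [Expr.label, reduceCtorEq, LExpr.var.injEq] at he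
    obtain ⟨rfl, rfl⟩ := he
    refine ⟨.nil, fun τ' hτ' => .free ?_, hr.ok, fun _ y b σ' hv => by cases hv⟩
    rw [← Env.get_eq_of_restrict_eq (by simp [Expr.fv]) (hr.agree_of_le hτ'), h]
  | @bound σ x v j h =>
    cases E <;> simp only [Expr.label, reduceCtorEq, LExpr.var.injEq] at he
    obtain ⟨rfl, rfl⟩ := he
    refine ⟨.nil, fun τ' hτ' => .bound ?_, hr.ok, fun hS => ?_⟩
    · rw [← Env.get_eq_of_restrict_eq (by simp [Expr.fv]) (hr.agree_of_le hτ'), h]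
    · have hx : x ∈ Vis R τ := hr.fv_subset (by simp [Expr.fv])
      obtain ⟨k, hk, hg⟩ := hr.ok x v
        (by rw [← Env.get_eq_of_restrict_eq (by simp [Expr.fv]) hr.agree, h])
        (by rintro k rfl; exact Vis.fn_notMem hx)
      -- By the data edge from binder to occurrence, an occurrence outside `S` was bound outside
      -- `S`.
      exact hg fun hkS => hS (hc k hk hkS)
  | @lam σ x b j =>
    cases E <;> simp only [Expr.label, reduceCtorEq, LExpr.lam.injEq] at he
    obtain ⟨rfl, rfl, rfl⟩ := he
    refine ⟨.nil, fun τ' hτ' => ?_, hr.ok, fun _ y b σ' hv => ?_⟩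
    · rw [hr.agree_of_le hτ']
      exact .lam
    · cases hv
      exact ⟨hr.fv_subset, hr.agree⟩
  | @appC σ σ' e₁ e₂ a₁ a₂ a₃ y b j h₁ h₂ hv h₃ ih₁ ih₂ ih₃ =>
    cases E <;> simp only [Expr.label, reduceCtorEq, LExpr.app.injEq] at he
    obtain ⟨he₁, he₂, rfl⟩ := he
    obtain ⟨hc, hc₁, hc₂, hc₃⟩ := hc
    obtain ⟨x₁, v₁, o₁, g₁⟩ := ih₁ he₁ hc₁ hr.appLeft
    have gr₁ := (h₁.labeled he₁).grows (R := R) hr.fresh.left (S := S) rfl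
    by_cases hS : a₁.id ∈ S
    · obtain ⟨x₂, v₂, o₂, g₂⟩ := ih₂ he₂ hc₂ (hr.appRight gr₁ o₁)
      have gr₂ := (h₂.labeled he₂).grows (R := R) (hr.appRight gr₁ o₁).fresh (S := S) rfl
      simp only [AExpr.extract, if_pos hS, Trace.program_append, Trace.bind_append]
      -- The body stays in place with the closure's own environment. Its value need not be good,
      -- because the application itself lies in `S`.
      refine ⟨x₁.append x₂, fun τ' hτ' => ?_, o₂, fun h => absurd (hc hS) h⟩
      exact .appC (v₁ τ' (gr₂.le.trans hτ')) (v₂ τ' hτ') (by simpa using hv) (by simpa using h₃)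
    · obtain ⟨hc₃, hβ, hc₄⟩ := hc₃ hS
      have gr₁' := gr₁.trans (.fn j (a₁.extract S).2.val _ _)
      have o₁' : EnvOK 𝒟 S β R ((.fn j, (a₁.extract S).2.val) :: Trace.bind τ (a₁.extract S).1) :=
        o₁.cons (Grows.fn j _ _ ∅).le fun h => absurd rfl (h j)
      obtain ⟨x₂, v₂, o₂, g₂⟩ := ih₂ he₂ hc₂ (hr.appRight gr₁' o₁')
      have gr₂ := (h₂.labeled he₂).grows (R := R) (hr.appRight gr₁' o₁').fresh (S := S) rfl
      set τ₂ := Trace.bind ((.fn j, (a₁.extract S).2.val) :: Trace.bind τ (a₁.extract S).1)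
        (a₂.extract S).1
      have hj : ∀ v, (Var.arg j, v) ∉ τ₂ := fun v hv' => by
        rcases gr₂.args j v hv' with ⟨w, hw⟩ | hw
        · rcases gr₁'.args j w hw with ⟨w, hw⟩ | hw
          · exact hr.fresh j w hw j.under_refl
          · exact ID.not_left_self hw
        · exact ID.not_right_self hw
      have gr₃ := Grows.arg (R := R) (P := {j}) (a₂.extract S).2.val hj rfl
      have o₃ := o₂.cons gr₃.le fun _ => ⟨_, hβ, by simpa using g₂⟩
      have hf : Fresh j.body τ₂ := gr₂.fresh (gr₁'.fresh hr.fresh.body fun _ hk =>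
        ID.not_body_of_left hk) fun _ hk => ID.not_body_of_right hk
      -- The function lies outside `S`, so its closure is good, and stays so while the argument is
      -- processed; hence its body may run in the flat environment.
      have hg := ((g₁ hS).mono (Grows.fn j (a₁.extract S).2.val _ ∅).le).mono gr₂.le
      rw [hv] at hg
      have hb := Ready.body hg hj o₃ hf
      rw [AExpr.extract_val S a₂] at hb o₃ gr₃
      obtain ⟨x₃, v₃, o₄, g₄⟩ := ih₃ rfl hc₄ hb
      simp only [AExpr.extract, if_neg hS, Trace.program_append, Trace.bind_append,
        Trace.bind_assume, Trace.bind_nil, Trace.program_cons, Trace.program_nil, AStmt.roll]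
      rw [AExpr.extract_val S a₂]
      refine ⟨(((x₁.append (.assume (v₁ _ (.refl _ _)) .nil)).append ?_).append
        (.assume (v₂ _ ?_) .nil)).append ?_, v₃, o₄, fun h => g₄ fun h' => h (hc₃ h')⟩
      · simpa using x₂
      · simpa [τ₂] using ScopeLE.refl R τ₂
      · simpa [τ₂] using x₃
  | @appS σ e₁ e₂ a₁ a₂ j h₁ h₂ hv ih₁ ih₂ =>
    cases E <;> simp only [Expr.label, reduceCtorEq, LExpr.app.injEq] at he
    obtain ⟨he₁, he₂, rfl⟩ := he
    obtain ⟨hc, hc₁, hc₂⟩ := hc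
    obtain ⟨x₁, v₁, o₁, g₁⟩ := ih₁ he₁ hc₁ hr.appLeft
    have gr₁ := (h₁.labeled he₁).grows (R := R) hr.fresh.left (S := S) rfl
    obtain ⟨x₂, v₂, o₂, g₂⟩ := ih₂ he₂ hc₂ (hr.appRight gr₁ o₁)
    have gr₂ := (h₂.labeled he₂).grows (R := R) (hr.appRight gr₁ o₁).fresh (S := S) rfl
    simp only [AExpr.extract, Trace.program_append, Trace.bind_append]
    refine ⟨x₁.append x₂, fun τ' hτ' => ?_, o₂, fun _ y b σ' hv' => by cases hv'⟩
    exact .appS (v₁ τ' (gr₂.le.trans hτ')) (v₂ τ' hτ') (by simpa using hv)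
  | @dist σ d ρ e a a' ev j h hev h' ih ih' =>
    cases E <;> simp only [Expr.label, reduceCtorEq, LExpr.dist.injEq] at he
    obtain ⟨rfl, rfl, he, rfl⟩ := he
    obtain ⟨hc, hc₁, hc₂⟩ := hc
    obtain ⟨x₁, v₁, o₁, g₁⟩ := ih he hc₁ hr.distLeft
    have gr₁ := (h.labeled he).grows (R := R) hr.fresh.left (S := S) rfl
    by_cases hS : j.choice ∈ S
    · simp only [AExpr.extract, if_pos hS]
      refine ⟨x₁, fun τ' hτ' => ?_, o₁, fun h => absurd (hc hS) h⟩
      refine .dist (v₁ τ' hτ') (by simpa using hev) (h'.congr rfl ?_)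
      -- A draw left in place was evaluated in `σ` but is now needed in `τ'`; the two agree on its
      -- free variables.
      exact Env.restrict_eq_mono (Expr.fv_draw_subset hev) (hr.agree_of_le (gr₁.le.trans hτ'))
    · obtain ⟨hc₂, hc₃⟩ := hc₂ hS
      obtain ⟨x₂, v₂, o₂, g₂⟩ := ih' rfl hc₃ (hr.draw gr₁ o₁ hev)
      simp only [AExpr.extract, if_neg hS, Trace.program_append, Trace.bind_append,
        Trace.bind_observe, Trace.bind_nil, Trace.program_cons, Trace.program_nil, AStmt.roll]
      refine ⟨(x₁.append (.observe (v₁ _ (.refl _ _)) (by simpa using hev) .nil)).append ?_,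
        v₂, o₂, fun h => g₂ fun h' => h (hc₂ h')⟩
      simpa using x₂

end ProbLang

namespace ProbLang

variable {D : Type u} {𝒟 : Dists D} {S : Set ID} {β : Set (Var × ID)} {R R' : Set Name}

/-! ## Every trace of the subprogram is extracted from a trace of the class -/

/-- Values of the same shape: both are closures of the same lambda expression, or neither is a
closure. -/
def Val.Sim (v w : Val D) : Prop :=
  ∀ y b, (∃ σ, v = .clo y b σ) ↔ ∃ σ, w = .clo y b σ

/-- The two environments bind the same variables, with values of the same shape outside `S`. -/
def SimEnv (S : Set ID) (β : Set (Var × ID)) (τ τ' : Env D) : Prop :=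
  ∀ x, (∀ k, x ≠ .fn k) → (τ.get x = none ∧ τ'.get x = none) ∨
    ∃ v v' j, τ.get x = some v ∧ τ'.get x = some v' ∧ (x, j) ∈ β ∧ (j ∉ S → v.Sim v')

theorem SimEnv.cons {τ τ' : Env D} {x : Var} {v v' : Val D} (h : SimEnv S β τ τ')
    (hx : (∀ k, x ≠ .fn k) → ∃ j, (x, j) ∈ β ∧ (j ∉ S → v.Sim v')) :
    SimEnv S β ((x, v) :: τ) ((x, v') :: τ') := by
  intro y hy
  by_cases hxy : x = y
  · subst hxy
    obtain ⟨j, hj⟩ := hx hy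
    exact .inr ⟨v, v', j, by simp [Env.get], by simp [Env.get], hj⟩
  · simpa [Env.get, hxy] using h y hy

/-- Whatever the statements and the expression extracted from `a₀` evaluate to, is extracted from an
equivalent evaluation of the original expression. -/
def Stitches (𝒟 : Dists D) (S : Set ID) (β : Set (Var × ID)) (R : Set Name) (σ₀ : Env D)
    (e : LExpr D) (a₀ : AExpr D) : Prop :=
  ∀ ⦃E : Expr D⦄ ⦃i : ID⦄ ⦃τ₀ σ τ τ' : Env D⦄ ⦃u : Trace D⦄ ⦃b : AExpr D⦄, e = E.label i →
    a₀.Closed S β → Ready 𝒟 S β R E i σ₀ τ₀ → Ready 𝒟 S β R E i σ τ → SimEnv S β τ₀ τ →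
    Exec 𝒟 τ (Trace.program (a₀.extract S).1) u → ScopeLE R (Trace.bind τ u) R τ' →
    Eval 𝒟 τ' (a₀.extract S).2.roll b →
    ∃ a, Eval 𝒟 σ e a ∧ AExpr.Equiv S a₀ a ∧ a.extract S = (u, b) ∧
      SimEnv S β (Trace.bind τ₀ (a₀.extract S).1) (Trace.bind τ u) ∧
      (a₀.id ∉ S → a₀.val.Sim a.val)

/-- The flat environments bind the same visible variables. For an occurrence outside `S`, the binder
is outside `S` too, and there `SimEnv` gives equal shapes. -/
theorem Stitches.var {σ₀ : Env D} {x : Var} {v₀ : Val D} {j : ID}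
    (h : Eval 𝒟 σ₀ (.var x j) (.var x v₀ j)) : Stitches 𝒟 S β R σ₀ (.var x j) (.var x v₀ j) := by
  intro E i τ₀ σ τ τ' u b he hc hr₀ hr hs hu hτ' hb
  cases E <;> simp only [Expr.label, reduceCtorEq, LExpr.var.injEq] at he
  obtain ⟨rfl, rfl⟩ := he
  cases hu
  have hx : x ∈ Vis R τ := hr.fv_subset (by simp [Expr.fv])
  have hg₀ : σ₀.get x = τ₀.get x := Env.get_eq_of_restrict_eq (by simp [Expr.fv]) hr₀.agree
  have hg : σ.get x = τ.get x := Env.get_eq_of_restrict_eq (by simp [Expr.fv]) hr.agree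
  have hg' : σ.get x = τ'.get x :=
    Env.get_eq_of_restrict_eq (by simp [Expr.fv]) (hr.agree_of_le hτ')
  have hsim := hs x (by rintro k rfl; exact Vis.fn_notMem hx)
  rw [← hg₀, ← hg] at hsim
  have key : ∀ v, Eval 𝒟 σ (.var x j) (.var x v j) → j ∉ S → v₀.Sim v := by
    intro v hv hj
    rcases hsim with ⟨hn₀, hn⟩ | ⟨w₀, w, k, hw₀, hw, hk, hS⟩
    · cases h with
      | free _ =>
        cases hv with
        | free _ => exact fun _ _ => Iff.rfl
        | bound h' => simp [hn] at h'
      | bound h' => simp [hn₀] at h'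
    · cases h with
      | free h' => simp [hw₀] at h'
      | bound h' =>
        cases hv with
        | free h' => simp [hw] at h'
        | bound h'' =>
          rw [h'] at hw₀
          rw [h''] at hw
          cases hw₀
          cases hw
          exact hS fun hkS => hj (hc k hk hkS)
  cases hb with
  | free h' =>
    have := Eval.free (𝒟 := 𝒟) (i := j) (hg'.trans h')
    exact ⟨_, this, .var, rfl, hs, key _ this⟩
  | bound h' =>
    have := Eval.bound (𝒟 := 𝒟) (i := j) (hg'.trans h')
    exact ⟨_, this, .var, rfl, hs, key _ this⟩

/-- Common part of the cases in which the application itself remains: the statements of function and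
argument all come first, and both remaining expressions are then evaluated in the same `τ'`. -/
theorem Stitches.args {σ₀ : Env D} {e₁ e₂ : LExpr D} {a₁ a₂ : AExpr D} (h₁ : Eval 𝒟 σ₀ e₁ a₁)
    (h₂ : Eval 𝒟 σ₀ e₂ a₂) (s₁ : Stitches 𝒟 S β R σ₀ e₁ a₁) (s₂ : Stitches 𝒟 S β R σ₀ e₂ a₂)
    {E₁ E₂ : Expr D} {i : ID} {τ₀ σ τ τ' : Env D} {u : Trace D} {b₁ b₂ : AExpr D}
    (he₁ : e₁ = E₁.label i.left) (he₂ : e₂ = E₂.label i.right)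
    (hc₁ : a₁.Closed S β) (hc₂ : a₂.Closed S β) (hr₀ : Ready 𝒟 S β R (.app E₁ E₂) i σ₀ τ₀)
    (hr : Ready 𝒟 S β R (.app E₁ E₂) i σ τ) (hs : SimEnv S β τ₀ τ)
    (hu : Exec 𝒟 τ (Trace.program (a₁.extract S).1 ++ Trace.program (a₂.extract S).1) u)
    (hτ' : ScopeLE R (Trace.bind τ u) R τ') (hb₁ : Eval 𝒟 τ' (a₁.extract S).2.roll b₁)
    (hb₂ : Eval 𝒟 τ' (a₂.extract S).2.roll b₂) :
    ∃ a₁' a₂', Eval 𝒟 σ e₁ a₁' ∧ Eval 𝒟 σ e₂ a₂' ∧ AExpr.Equiv S a₁ a₁' ∧ AExpr.Equiv S a₂ a₂' ∧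
      (a₁'.extract S).1 ++ (a₂'.extract S).1 = u ∧ (a₁'.extract S).2 = b₁ ∧
      (a₂'.extract S).2 = b₂ ∧
      SimEnv S β (Trace.bind τ₀ ((a₁.extract S).1 ++ (a₂.extract S).1)) (Trace.bind τ u) ∧
      (a₁.id ∉ S → a₁.val.Sim a₁'.val) := by
  obtain ⟨u₁, u₂, rfl, hu₁, hu₂⟩ := hu.split
  rw [Trace.bind_append] at hτ'
  have gr₁ := (h₁.labeled he₁).grows (R := R) hr.fresh.left hu₁.program_eq
  have gr₂ := (h₂.labeled he₂).grows (R := R)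
    (gr₁.fresh hr.fresh.right fun _ hk => ID.not_right_of_left hk) hu₂.program_eq
  obtain ⟨a₁', k₁, q₁, x₁, hs₁, sim⟩ :=
    s₁ he₁ hc₁ hr₀.appLeft hr.appLeft hs hu₁ (gr₂.le.trans hτ') hb₁
  have o₀ := (h₁.extract_spec he₁ hc₁ hr₀.appLeft).2.2.1
  have o := (k₁.extract_spec he₁ (q₁.closed hc₁) hr.appLeft).2.2.1
  have gr₀ := (h₁.labeled he₁).grows (R := R) hr₀.fresh.left (S := S) rfl
  rw [x₁] at o
  obtain ⟨a₂', k₂, q₂, x₂, hs₂, -⟩ :=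
    s₂ he₂ hc₂ (hr₀.appRight gr₀ o₀) (hr.appRight gr₁ o) hs₁ hu₂ hτ' hb₂
  exact ⟨a₁', a₂', k₁, k₂, q₁, q₂, by rw [x₁, x₂], by rw [x₁], by rw [x₂],
    by simpa using hs₂, sim⟩

/-- With the function in `S` the new run may be symbolic or not, whatever `a` was. The equivalence
allows this, and the new body is copied from `b`. -/
theorem Stitches.app_of_mem {σ₀ : Env D} {e₁ e₂ : LExpr D} {a a₁ a₂ : AExpr D} {j : ID}
    (h₁ : Eval 𝒟 σ₀ e₁ a₁) (h₂ : Eval 𝒟 σ₀ e₂ a₂) (s₁ : Stitches 𝒟 S β R σ₀ e₁ a₁)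
    (s₂ : Stitches 𝒟 S β R σ₀ e₂ a₂) (ha : a.IsApp a₁ a₂ j) (hS : a₁.id ∈ S) :
    Stitches 𝒟 S β R σ₀ (.app e₁ e₂ j) a := by
  intro E i τ₀ σ τ τ' u b he hc hr₀ hr hs hu hτ' hb
  cases E <;> simp only [Expr.label, reduceCtorEq, LExpr.app.injEq] at he
  obtain ⟨he₁, he₂, rfl⟩ := he
  have hx : (a.extract S).1 = (a₁.extract S).1 ++ (a₂.extract S).1 ∧
      (a.extract S).2.roll = .app (a₁.extract S).2.roll (a₂.extract S).2.roll j := by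
    rcases ha with rfl | ⟨a₃, rfl⟩ <;> simp [AExpr.extract, hS, AExpr.roll]
  have hc' : (a₁.id ∈ S → j ∈ S) ∧ a₁.Closed S β ∧ a₂.Closed S β := by
    rcases ha with rfl | ⟨a₃, rfl⟩
    · exact hc
    · exact ⟨hc.1, hc.2.1, hc.2.2.1⟩
  obtain ⟨hj, hc₁, hc₂⟩ := hc'
  rw [hx.1, Trace.program_append] at hu
  rw [hx.2] at hb
  rw [hx.1]
  cases hb with
  | @appC _ σ' _ _ b₁ b₂ b₃ y b' _ hb₁ hb₂ hv h₃ =>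
    obtain ⟨a₁', a₂', k₁, k₂, q₁, q₂, rfl, rfl, rfl, hs', -⟩ :=
      Stitches.args h₁ h₂ s₁ s₂ he₁ he₂ hc₁ hc₂ hr₀ hr hs hu hτ' hb₁ hb₂
    refine ⟨.appC a₁' a₂' b₃ j, .appC k₁ k₂ (by simpa using hv) (by simpa using h₃),
      .app_mem hS ha (.inr ⟨_, rfl⟩) q₁ q₂, ?_, hs', fun h => absurd (hj hS) (ha.id_eq ▸ h)⟩
    simp [AExpr.extract, ← q₁.id_eq, hS]
  | @appS _ _ _ b₁ b₂ _ hb₁ hb₂ hv =>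
    obtain ⟨a₁', a₂', k₁, k₂, q₁, q₂, rfl, rfl, rfl, hs', -⟩ :=
      Stitches.args h₁ h₂ s₁ s₂ he₁ he₂ hc₁ hc₂ hr₀ hr hs hu hτ' hb₁ hb₂
    exact ⟨.appS a₁' a₂' j, .appS k₁ k₂ (by simpa using hv),
      .app_mem hS ha (.inl rfl) q₁ q₂, rfl, hs', fun h => absurd (hj hS) (ha.id_eq ▸ h)⟩

/-- Outside `S` the function keeps its shape, so a symbolic application cannot turn into a closure
application. -/
theorem Stitches.appS_of_notMem {σ₀ : Env D} {e₁ e₂ : LExpr D} {a₁ a₂ : AExpr D} {j : ID}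
    (h₁ : Eval 𝒟 σ₀ e₁ a₁) (h₂ : Eval 𝒟 σ₀ e₂ a₂) (s₁ : Stitches 𝒟 S β R σ₀ e₁ a₁)
    (s₂ : Stitches 𝒟 S β R σ₀ e₂ a₂) (hv₀ : ∀ y b σ', a₁.val ≠ .clo y b σ') (hS : a₁.id ∉ S) :
    Stitches 𝒟 S β R σ₀ (.app e₁ e₂ j) (.appS a₁ a₂ j) := by
  intro E i τ₀ σ τ τ' u b he hc hr₀ hr hs hu hτ' hb
  cases E <;> simp only [Expr.label, reduceCtorEq, LExpr.app.injEq] at he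
  obtain ⟨he₁, he₂, rfl⟩ := he
  obtain ⟨-, hc₁, hc₂⟩ := hc
  simp only [AExpr.extract, Trace.program_append] at hu
  simp only [AExpr.extract, AExpr.roll] at hb
  cases hb with
  | @appC _ σ' _ _ b₁ b₂ b₃ y b' _ hb₁ hb₂ hv h₃ =>
    obtain ⟨a₁', a₂', k₁, k₂, q₁, q₂, rfl, rfl, rfl, hs', sim⟩ :=
      Stitches.args h₁ h₂ s₁ s₂ he₁ he₂ hc₁ hc₂ hr₀ hr hs hu hτ' hb₁ hb₂
    obtain ⟨σ'', hσ⟩ := (sim hS y b').2 ⟨σ', by simpa using hv⟩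
    exact absurd hσ (hv₀ _ _ _)
  | @appS _ _ _ b₁ b₂ _ hb₁ hb₂ hv =>
    obtain ⟨a₁', a₂', k₁, k₂, q₁, q₂, rfl, rfl, rfl, hs', -⟩ :=
      Stitches.args h₁ h₂ s₁ s₂ he₁ he₂ hc₁ hc₂ hr₀ hr hs hu hτ' hb₁ hb₂
    exact ⟨.appS a₁' a₂' j, .appS k₁ k₂ (by simpa using hv), .appS hS q₁ q₂, rfl, hs',
      fun _ y b => by simp [AExpr.val]⟩

theorem Exec.assume_inv {τ : Env D} {x : Var} {e : LExpr D} {u : Trace D}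
    (h : Exec 𝒟 τ [.assume x e] u) : ∃ a, u = [.assume x a] ∧ Eval 𝒟 τ e a := by
  cases h with
  | assume h ht => cases ht; exact ⟨_, rfl, h⟩

theorem Exec.observe_inv {τ : Env D} {d : D} {e : LExpr D} {ev : VExpr} {c : ID} {u : Trace D}
    (h : Exec 𝒟 τ [.observe d e ev c] u) :
    ∃ a, u = [.observe d a ev c] ∧ Eval 𝒟 τ e a ∧ ev ∈ 𝒟.outcomes d a.val := by
  cases h with
  | observe h hev ht => cases ht; exact ⟨_, rfl, h, hev⟩

theorem Fresh.arg_notMem {i : ID} {τ₀ τ₁ τ₂ : Env D} (h : Fresh i τ₀)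
    (h₁ : Grows R {k | i.left.Under k} τ₀ τ₁) (h₂ : Grows R {k | i.right.Under k} τ₁ τ₂)
    (v : Val D) : (Var.arg i, v) ∉ τ₂ := fun hv => by
  rcases h₂.args i v hv with ⟨w, hw⟩ | hw
  · rcases h₁.args i w hw with ⟨w, hw⟩ | hw
    · exact h i w hw i.under_refl
    · exact ID.not_left_self hw
  · exact ID.not_right_self hw

/-- The subprogram contains the statements extracted from the body seen in the template. They fit
the new run because its function is a closure of the same lambda expression, possibly with another
environment; goodness on both sides makes the body ready in both flat environments. -/
theorem Stitches.appC_of_notMem {σ₀ σ₀' : Env D} {e₁ e₂ : LExpr D} {a₁ a₂ a₃ : AExpr D} {y : Name}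
    {b₀ : Expr D} {j : ID} (h₁ : Eval 𝒟 σ₀ e₁ a₁) (h₂ : Eval 𝒟 σ₀ e₂ a₂)
    (s₁ : Stitches 𝒟 S β R σ₀ e₁ a₁) (s₂ : Stitches 𝒟 S β R σ₀ e₂ a₂)
    (hv₀ : a₁.val = .clo y b₀ σ₀')
    (s₃ : Stitches 𝒟 S β R ((.arg j, a₂.val) :: σ₀') ((b₀.subst y (.arg j)).label j.body) a₃)
    (hS : a₁.id ∉ S) : Stitches 𝒟 S β R σ₀ (.app e₁ e₂ j) (.appC a₁ a₂ a₃ j) := by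
  intro E i τ₀ σ τ τ' u b he hc hr₀ hr hs hu hτ' hb
  cases E <;> simp only [Expr.label, reduceCtorEq, LExpr.app.injEq] at he
  obtain ⟨he₁, he₂, rfl⟩ := he
  obtain ⟨-, hc₁, hc₂, hc₃⟩ := hc
  obtain ⟨hc₃, hβ, hc₄⟩ := hc₃ hS
  simp only [AExpr.extract, if_neg hS, Trace.program_append, Trace.program_cons,
    Trace.program_nil, AStmt.roll] at hu hb
  obtain ⟨u', u₃, rfl, hu', hu₃⟩ := hu.split
  obtain ⟨u', w₂, rfl, hu', hw₂⟩ := hu'.split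
  obtain ⟨u', u₂, rfl, hu', hu₂⟩ := hu'.split
  obtain ⟨u₁, w₁, rfl, hu₁, hw₁⟩ := hu'.split
  obtain ⟨b₁, rfl, hb₁⟩ := hw₁.assume_inv
  obtain ⟨b₂, rfl, hb₂⟩ := hw₂.assume_inv
  simp only [Trace.bind_append, Trace.bind_assume, Trace.bind_nil] at hb₁ hu₂ hb₂ hu₃ hτ'
  -- the function
  obtain ⟨a₁', k₁, q₁, x₁, hs₁, sim⟩ :=
    s₁ he₁ hc₁ hr₀.appLeft hr.appLeft hs hu₁ (.refl _ _) hb₁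
  obtain ⟨-, -, o₀, g₀⟩ := h₁.extract_spec he₁ hc₁ hr₀.appLeft
  obtain ⟨-, -, o, g⟩ := k₁.extract_spec he₁ (q₁.closed hc₁) hr.appLeft
  rw [x₁, ← q₁.id_eq] at g
  rw [x₁] at o
  -- Same parameter and body as in the template; only the captured environment `σ'` is new.
  obtain ⟨σ', hv⟩ := (sim hS y b₀).1 ⟨σ₀', hv₀⟩
  have hb₁v : b₁.val = a₁'.val := by rw [← AExpr.extract_val S a₁', x₁]
  have gr₀ := ((h₁.labeled he₁).grows (R := R) hr₀.fresh.left (S := S) rfl).trans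
    (.fn j a₁.val _ _)
  have gr := ((h₁.labeled he₁).grows (R := R) hr.fresh.left hu₁.program_eq).trans
    (.fn j b₁.val _ _)
  replace o₀ := o₀.cons (v := a₁.val) (Grows.fn j _ _ ∅).le fun h => absurd rfl (h j)
  replace o := o.cons (v := b₁.val) (Grows.fn j _ _ ∅).le fun h => absurd rfl (h j)
  replace g₀ := (g₀ hS).mono (Grows.fn j a₁.val _ ∅).le
  replace g := (g hS).mono (Grows.fn j b₁.val _ ∅).le
  replace hs₁ := hs₁.cons (x := .fn j) (v := a₁.val) (v' := b₁.val) fun h => absurd rfl (h j)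
  have r₀ := hr₀.appRight gr₀ o₀
  have r := hr.appRight gr o
  -- the argument
  obtain ⟨a₂', k₂, q₂, x₂, hs₂, sim₂⟩ := s₂ he₂ hc₂ r₀ r hs₁ hu₂ (.refl _ _) hb₂
  obtain ⟨-, -, p₀, d₀⟩ := h₂.extract_spec he₂ hc₂ r₀
  obtain ⟨-, -, p, d⟩ := k₂.extract_spec he₂ (q₂.closed hc₂) r
  rw [x₂, ← q₂.id_eq] at d
  rw [x₂] at p
  have hb₂v : b₂.val = a₂'.val := by rw [← AExpr.extract_val S a₂', x₂]
  have gs₀ := (h₂.labeled he₂).grows (R := R) r₀.fresh (S := S) rfl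
  have gs := (h₂.labeled he₂).grows (R := R) r.fresh hu₂.program_eq
  have n₀ := hr₀.fresh.arg_notMem gr₀ gs₀
  have n := hr.fresh.arg_notMem gr gs
  have f₀ := gs₀.fresh (gr₀.fresh hr₀.fresh.body fun _ hk => ID.not_body_of_left hk)
    fun _ hk => ID.not_body_of_right hk
  have f := gs.fresh (gr.fresh hr.fresh.body fun _ hk => ID.not_body_of_left hk)
    fun _ hk => ID.not_body_of_right hk
  replace p₀ := p₀.cons (Grows.arg (P := {j}) a₂.val n₀ rfl).le fun _ => ⟨_, hβ, d₀⟩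
  replace p := p.cons (Grows.arg (P := {j}) a₂'.val n rfl).le fun _ => ⟨_, hβ, d⟩
  replace g₀ := g₀.mono gs₀.le
  replace g := g.mono gs.le
  replace g₀ : Good 𝒟 R _ (.clo y b₀ σ₀') := fun y' b' σ'' h => g₀ y' b' σ'' (hv₀.trans h)
  replace g : Good 𝒟 R _ (.clo y b₀ σ') := fun y' b' σ'' h => g y' b' σ'' (hv.trans h)
  rw [hb₂v] at hu₃ hτ'
  -- the body
  obtain ⟨a₃', k₃, q₃, x₃, hs₃, sim₃⟩ := s₃ rfl hc₄ (Ready.body g₀ n₀ p₀ f₀)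
    (Ready.body g n p f) (hs₂.cons fun _ => ⟨_, hβ, sim₂⟩) hu₃ hτ' hb
  refine ⟨.appC a₁' a₂' a₃' j, .appC k₁ k₂ hv k₃, .appC hS q₁ q₂ q₃, ?_, ?_,
    fun h => sim₃ fun h' => h (hc₃ h')⟩
  · simp [AExpr.extract, ← q₁.id_eq, hS, x₁, x₂, x₃]
  · simpa [AExpr.extract, hS, hb₂v] using hs₃

/-- For a choice in `S`, draw and evaluation are taken from the new run and moved back to `σ`.
Otherwise the observation in the subprogram fixes the outcome `ev`, so the same draw is evaluated.
-/
theorem Stitches.dist {σ₀ : Env D} {d : D} {ρ : List (Name × Var)} {e : LExpr D} {a a' : AExpr D}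
    {ev : VExpr} {j : ID} (h : Eval 𝒟 σ₀ e a) (hev : ev ∈ 𝒟.outcomes d a.val)
    (s : Stitches 𝒟 S β R σ₀ e a)
    (s' : Stitches 𝒟 S β R σ₀ ((ev.toExpr.rename ρ).label j.body) a') :
    Stitches 𝒟 S β R σ₀ (.dist d ρ e j) (.dist d ρ a ev a' j) := by
  intro E i τ₀ σ τ τ' u b he hc hr₀ hr hs hu hτ' hb
  cases E <;> simp only [Expr.label, reduceCtorEq, LExpr.dist.injEq] at he
  obtain ⟨rfl, rfl, he, rfl⟩ := he
  obtain ⟨hj, hc₁, hc₂⟩ := hc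
  by_cases hS : j.choice ∈ S
  · simp only [AExpr.extract, if_pos hS, AExpr.roll] at hu hb
    cases hb with
    | @dist _ _ _ _ b b' ev' _ hb hev' hb' =>
      obtain ⟨a₁, k₁, q₁, x₁, hs₁, -⟩ := s he hc₁ hr₀.distLeft hr.distLeft hs hu hτ' hb
      have gr := (h.labeled he).grows (R := R) hr.fresh.left hu.program_eq
      have hv : b.val = a₁.val := by rw [← AExpr.extract_val S a₁, x₁]
      refine ⟨.dist d ρ a₁ ev' b' j, .dist k₁ (hv ▸ hev') (hb'.congr rfl ?_), .dist_mem hS q₁, ?_,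
        ?_, fun h => absurd (hj hS) h⟩
      · exact (Env.restrict_eq_mono (Expr.fv_draw_subset hev')
          (hr.agree_of_le (gr.le.trans hτ'))).symm
      · simp [AExpr.extract, hS, x₁]
      · simpa [AExpr.extract, hS] using hs₁
  · obtain ⟨hc₂, hc₃⟩ := hc₂ hS
    simp only [AExpr.extract, if_neg hS, Trace.program_append, Trace.program_cons,
      Trace.program_nil, AStmt.roll] at hu hb
    obtain ⟨u', u₂, rfl, hu', hu₂⟩ := hu.split
    obtain ⟨u₁, w, rfl, hu₁, hw⟩ := hu'.split
    obtain ⟨b₁, rfl, hb₁, hev'⟩ := hw.observe_inv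
    simp only [Trace.bind_append, Trace.bind_observe, Trace.bind_nil] at hb₁ hu₂ hτ'
    obtain ⟨a₁, k₁, q₁, x₁, hs₁, -⟩ := s he hc₁ hr₀.distLeft hr.distLeft hs hu₁ (.refl _ _) hb₁
    have o₀ := (h.extract_spec he hc₁ hr₀.distLeft).2.2.1
    have o := (k₁.extract_spec he (q₁.closed hc₁) hr.distLeft).2.2.1
    rw [x₁] at o
    have gr₀ := (h.labeled he).grows (R := R) hr₀.fresh.left (S := S) rfl
    have gr := (h.labeled he).grows (R := R) hr.fresh.left hu₁.program_eq
    have hv : b₁.val = a₁.val := by rw [← AExpr.extract_val S a₁, x₁]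
    rw [hv] at hev'
    obtain ⟨a₂, k₂, q₂, x₂, hs₂, sim⟩ := s' rfl hc₃ (hr₀.draw gr₀ o₀ hev) (hr.draw gr o hev') hs₁
      hu₂ hτ' hb
    refine ⟨.dist d ρ a₁ ev a₂ j, .dist k₁ hev' k₂, .dist_notMem hS q₁ q₂, ?_, ?_,
      fun h => sim fun h' => h (hc₂ h')⟩
    · simp [AExpr.extract, hS, x₁, x₂]
    · simpa [AExpr.extract, hS] using hs₂

theorem Eval.stitches {σ₀ : Env D} {e : LExpr D} {a₀ : AExpr D} (h : Eval 𝒟 σ₀ e a₀) :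
    Stitches 𝒟 S β R σ₀ e a₀ := by
  induction h with
  | free h => exact .var (.free h)
  | bound h => exact .var (.bound h)
  | lam =>
    intro E i τ₀ σ τ τ' u b he hc hr₀ hr hs hu hτ' hb
    cases E <;> simp only [Expr.label, reduceCtorEq, LExpr.lam.injEq] at he
    obtain ⟨rfl, rfl, rfl⟩ := he
    cases hu
    cases hb
    refine ⟨_, .lam, .lam, ?_, hs, fun _ y b => ?_⟩
    · rw [hr.agree_of_le hτ']
      rfl
    · simp [AExpr.val]
  | @appC _ _ _ _ a₁ _ _ _ _ _ h₁ h₂ hv _ ih₁ ih₂ ih₃ =>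
    by_cases hS : a₁.id ∈ S
    · exact .app_of_mem h₁ h₂ ih₁ ih₂ (.inr ⟨_, rfl⟩) hS
    · exact .appC_of_notMem h₁ h₂ ih₁ ih₂ hv ih₃ hS
  | @appS _ _ _ a₁ _ _ h₁ h₂ hv ih₁ ih₂ =>
    by_cases hS : a₁.id ∈ S
    · exact .app_of_mem h₁ h₂ ih₁ ih₂ (.inl rfl) hS
    · exact .appS_of_notMem h₁ h₂ ih₁ ih₂ hv hS
  | dist h hev _ ih ih' => exact .dist h hev ih ih'

end ProbLang

namespace ProbLang

variable {D : Type u} {𝒟 : Dists D} {S S' : Set ID} {β : Set (Var × ID)}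

/-! ## Extraction from traces -/

/-- The identifiers in a statement of a trace are those of some statement of a program. -/
def AStmt.Labeled : AStmt D → Prop
  | .assume _ a => ∃ k, a.Labeled (.stmt k)
  | .observe _ a _ c => ∃ k, a.Labeled (ID.stmt k).left ∧ c = (ID.stmt k).choice

theorem Exec.labeled {p : Prog D} {k : ℕ} {σ : Env D} {t : Trace D}
    (h : Exec 𝒟 σ (Prog.labelFrom k p) t) : ∀ s ∈ t, s.Labeled := by
  induction p generalizing k σ t with
  | nil => cases h; simp
  | cons s p ih =>
    cases s with
    | assume x e =>
      cases h with
      | assume h ht =>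
        rintro s (_ | ⟨_, hs⟩)
        · exact ⟨k, h.labeled rfl⟩
        · exact ih ht s hs
    | observe d e ev =>
      cases h with
      | observe h _ ht =>
        rintro s (_ | ⟨_, hs⟩)
        · exact ⟨k, h.labeled rfl, rfl⟩
        · exact ih ht s hs

/-- The part of the validity of a subproblem `S` that concerns statements that are extracted. -/
def AStmt.Closed (S : Set ID) (β : Set (Var × ID)) : AStmt D → Prop
  | .assume x a => (x, a.id) ∈ β ∧ a.Closed S β
  | .observe _ a _ _ => a.Closed S β

theorem AExpr.exists_choice_of_mem_samples {a : AExpr D} {i : ID} (h : i ∈ a.samples) :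
    ∃ k, i = .choice k := by
  induction a with
  | var | lam => exact h.elim
  | appC a₁ a₂ a₃ j ih₁ ih₂ ih₃ => exact h.elim (fun h => h.elim ih₁ ih₂) ih₃
  | appS a₁ a₂ j ih₁ ih₂ => exact h.elim ih₁ ih₂
  | dist d ρ a ev a' j ih ih' => exact h.elim (fun h => h.elim (fun h => ⟨j, h⟩) ih) ih'

theorem ValidSubproblem.closed {t : Trace D} (h : ValidSubproblem t S)
    (hl : ∀ s ∈ t, s.Labeled) : ∀ s ∈ t, s.Closed S (Trace.binders t) := by
  have hsamp : ∀ i ∈ Trace.samples t, ∃ k, i = .choice k := by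
    rintro i ⟨s, hs, hi⟩
    cases s with
    | assume x a => exact AExpr.exists_choice_of_mem_samples hi
    | observe d a ev c =>
      rcases hi with rfl | hi
      · obtain ⟨k, -, rfl⟩ := hl _ hs
        exact ⟨_, rfl⟩
      · exact AExpr.exists_choice_of_mem_samples hi
  intro s hs
  cases s with
  | assume x a =>
    obtain ⟨k, hk⟩ := hl _ hs
    refine ⟨⟨_, hs, .inl rfl⟩, hk.closed (by simp) (fun q hq => ⟨_, hs, .inr hq⟩) ?_⟩
    exact fun q hq h₁ h₂ => hsamp _ (h.2.2 q.1 h₁ q.2 ⟨_, hs, hq⟩ h₂)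
  | observe d a ev c =>
    obtain ⟨k, hk, rfl⟩ := hl _ hs
    refine hk.closed (by simp) (fun q hq => ⟨_, hs, hq⟩) ?_
    exact fun q hq h₁ h₂ => hsamp _ (h.2.2 q.1 h₁ q.2 ⟨_, hs, .inr hq⟩ h₂)

@[simp] theorem Trace.extract_nil : Trace.extract ([] : Trace D) S = [] := rfl

@[simp] theorem Trace.extract_cons (s : AStmt D) (t : Trace D) :
    Trace.extract (s :: t) S = s.extract S ++ Trace.extract t S := rfl

/-- The statements `p`, of which the first has position `k`, can be executed in the flat environment
`τ` instead of `σ`. -/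
structure Top (𝒟 : Dists D) (S : Set ID) (β : Set (Var × ID)) (p : Prog D) (k : ℕ)
    (σ τ : Env D) : Prop where
  agree : σ.restrict (Set.range Var.src) = τ.restrict (Set.range Var.src)
  ok : EnvOK 𝒟 S β {x | x ∈ Prog.assigned p} τ
  fresh : ∀ j v, (Var.arg j, v) ∈ τ → ∃ l < k, (ID.stmt l).Under j

/-- Here the variable convention enters: the free variables of a statement are source names that are
not assigned in it or later, hence visible. Arguments bound so far belong to earlier statements. -/
theorem Top.ready {s : Stmt D} {p : Prog D} {k : ℕ} {σ τ : Env D} (h : Top 𝒟 S β (s :: p) k σ τ)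
    (hwf : Prog.WellFormed 𝒟 (s :: p)) {i : ID}
    (hi : ∀ j, i.Under j → (ID.stmt k).Under j) :
    Ready 𝒟 S β {x | x ∈ Prog.assigned (s :: p)} s.expr i σ τ := by
  have hsrc := Expr.fv_subset_range_src (𝒟 := 𝒟) hwf.1
  refine ⟨Env.restrict_eq_mono hsrc h.agree, fun x hx => ?_, h.ok, fun j v hj hu => ?_⟩
  · obtain ⟨n, rfl⟩ := hsrc hx
    exact Vis.src_mem.2 fun hn => hwf.2.1 n hn hx
  · obtain ⟨l, hl, hlj⟩ := h.fresh j v hj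
    exact hl.ne (ID.stmt_eq_of_under hlj (hi j hu))

theorem Top.bind {p : Prog D} {k : ℕ} {σ τ : Env D} (h : Top 𝒟 S β p k σ τ) {i : ID}
    (hi : ∀ j, i.Under j → (ID.stmt k).Under j) {a : AExpr D} (ha : a.Labeled i) {u : Trace D}
    (hu : Trace.program u = Trace.program (a.extract S).1)
    (hok : EnvOK 𝒟 S β {x | x ∈ Prog.assigned p} (Trace.bind τ u)) :
    Top 𝒟 S β p (k + 1) σ (Trace.bind τ u) := by
  refine ⟨h.agree.trans (Trace.restrict_bind ?_).symm, hok, fun j v hj => ?_⟩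
  · rintro x hx ⟨n, rfl⟩
    obtain ⟨j, -, hj | hj⟩ := ha.bound_extract S (hu ▸ hx) <;> cases hj
  · have hf : Fresh i τ := fun j v hj hu => by
      obtain ⟨l, hl, hlj⟩ := h.fresh j v hj
      exact hl.ne (ID.stmt_eq_of_under hlj (hi j hu))
    rcases (ha.grows (R := ∅) hf hu).args j v hj with ⟨v', hv⟩ | hj
    · obtain ⟨l, hl, hlj⟩ := h.fresh j v' hv
      exact ⟨l, by omega, hlj⟩
    · exact ⟨k, by omega, hi j hj⟩

theorem Top.assign {x : Name} {E : Expr D} {p : Prog D} {k : ℕ} {σ τ : Env D}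
    (h : Top 𝒟 S β (.assume x E :: p) k σ τ) {v : Val D} {j : ID} (hj : (.src x, j) ∈ β)
    (hv : j ∉ S → Good 𝒟 {x' | x' ∈ Prog.assigned (.assume x E :: p)} τ v) :
    Top 𝒟 S β p k ((.src x, v) :: σ) ((.src x, v) :: τ) := by
  refine ⟨?_, h.ok.cons (.cons v ?_ ?_) fun _ => ⟨j, hj, hv⟩, fun i w hi => ?_⟩
  · rw [Env.restrict_cons_of_mem (Set.mem_range_self x),
      Env.restrict_cons_of_mem (Set.mem_range_self x), h.agree]
  · exact fun y hy => List.mem_cons_of_mem _ hy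
  -- The name `x` was still to be assigned, hence invisible, so nothing visible is shadowed.
  · exact fun hx => Vis.src_mem.1 hx List.mem_cons_self
  · exact h.fresh i w (by simpa using hi)

/-! ### Validity and stitching for whole programs -/

theorem Exec.extract {p : Prog D} {k : ℕ} {σ τ : Env D} {t : Trace D}
    (h : Exec 𝒟 σ (Prog.labelFrom k p) t) (hwf : Prog.WellFormed 𝒟 p) (ht : Top 𝒟 S β p k σ τ)
    (hc : ∀ s ∈ t, s.Closed S β) :
    Exec 𝒟 τ (Trace.program (Trace.extract t S)) (Trace.extract t S) := by
  induction p generalizing k σ τ t with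
  | nil => cases h; exact .nil
  | cons s p ih =>
    cases s with
    | assume x e =>
      cases h with
      | @assume _ _ _ a _ t h hrest =>
        obtain ⟨hβ, hca⟩ := hc _ List.mem_cons_self
        have hi : ∀ j, (ID.stmt k).Under j → (ID.stmt k).Under j := fun _ => id
        obtain ⟨x₁, v₁, o₁, g₁⟩ := h.extract_spec rfl hca (ht.ready hwf hi)
        have ht' := ih hrest hwf.2.2.2 ((ht.bind hi (h.labeled rfl) rfl o₁).assign hβ g₁)
          fun s hs => hc s (List.mem_cons_of_mem _ hs)
        simp only [Trace.extract_cons, AStmt.extract, Trace.program_append, Trace.program_cons,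
          Trace.program_nil, AStmt.roll]
        exact (x₁.append (.assume (v₁ _ (.refl _ _)) .nil)).append (by simpa using ht')
    | observe d e ev =>
      cases h with
      | @observe _ _ _ a _ _ _ t h hev hrest =>
        have hca := hc _ List.mem_cons_self
        have hi : ∀ j, (ID.stmt k).left.Under j → (ID.stmt k).Under j := fun _ => ID.under_of_left
        obtain ⟨x₁, v₁, o₁, g₁⟩ := h.extract_spec rfl hca (ht.ready hwf hi)
        have hb := ht.bind hi (h.labeled rfl) rfl o₁
        have ht' := ih hrest hwf.2.2.2 ⟨hb.agree, hb.ok, hb.fresh⟩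
          fun s hs => hc s (List.mem_cons_of_mem _ hs)
        simp only [Trace.extract_cons, AStmt.extract, Trace.program_append, Trace.program_cons,
          Trace.program_nil, AStmt.roll]
        exact (x₁.append (.observe (v₁ _ (.refl _ _)) (by simpa using hev) .nil)).append
          (by simpa using ht')

/-- Core of surjectivity: `t₀` is a template, `u` an arbitrary run of the program extracted from it,
and `Stitches` is applied statement by statement with one fixed `S`. -/
theorem Exec.stitch {p : Prog D} {k : ℕ} {σ₀ σ τ₀ τ : Env D} {t₀ u : Trace D}
    (h : Exec 𝒟 σ₀ (Prog.labelFrom k p) t₀) (hwf : Prog.WellFormed 𝒟 p)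
    (ht₀ : Top 𝒟 S β p k σ₀ τ₀) (ht : Top 𝒟 S β p k σ τ) (hs : SimEnv S β τ₀ τ)
    (hc : ∀ s ∈ t₀, s.Closed S β) (hu : Exec 𝒟 τ (Trace.program (Trace.extract t₀ S)) u) :
    ∃ t, Exec 𝒟 σ (Prog.labelFrom k p) t ∧ Trace.Equiv S t₀ t ∧ Trace.extract t S = u := by
  induction p generalizing k σ₀ σ τ₀ τ t₀ u with
  | nil => cases h; cases hu; exact ⟨[], .nil, .nil, rfl⟩
  | cons s p ih =>
    cases s with
    | assume x e =>
      cases h with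
      | @assume _ _ _ a _ t₀ h hrest =>
        obtain ⟨hβ, hca⟩ := hc _ List.mem_cons_self
        simp only [Trace.extract_cons, AStmt.extract, Trace.program_append, Trace.program_cons,
          Trace.program_nil, AStmt.roll] at hu
        obtain ⟨u', u₂, rfl, hu', hu₂⟩ := hu.split
        obtain ⟨u₁, w, rfl, hu₁, hw⟩ := hu'.split
        obtain ⟨b, rfl, hb⟩ := hw.assume_inv
        have hi : ∀ j, (ID.stmt k).Under j → (ID.stmt k).Under j := fun _ => id
        have r₀ := ht₀.ready hwf hi
        have r := ht.ready hwf hi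
        obtain ⟨a', k', q, x₁, hs', sim⟩ := h.stitches rfl hca r₀ r hs hu₁ (.refl _ _) hb
        obtain ⟨-, -, o₀, g₀⟩ := h.extract_spec rfl hca r₀
        obtain ⟨-, -, o, g⟩ := k'.extract_spec rfl (q.closed hca) r
        have hv : b.val = a'.val := by rw [← AExpr.extract_val S a', x₁]
        rw [x₁, ← q.id_eq] at g
        rw [x₁] at o
        simp only [Trace.bind_append, Trace.bind_assume, Trace.bind_nil, hv] at hu₂
        obtain ⟨t, ht, hq, rfl⟩ := ih hrest hwf.2.2.2
          ((ht₀.bind hi (h.labeled rfl) rfl o₀).assign hβ g₀)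
          ((ht.bind hi (h.labeled rfl) hu₁.program_eq o).assign hβ g)
          (hs'.cons fun _ => ⟨_, hβ, sim⟩) (fun s hs => hc s (List.mem_cons_of_mem _ hs)) hu₂
        exact ⟨_, .assume k' ht, .assume q hq, by simp [AStmt.extract, x₁]⟩
    | observe d e ev =>
      cases h with
      | @observe _ _ _ a _ _ _ t₀ h hev hrest =>
        have hca := hc _ List.mem_cons_self
        simp only [Trace.extract_cons, AStmt.extract, Trace.program_append, Trace.program_cons,
          Trace.program_nil, AStmt.roll] at hu
        obtain ⟨u', u₂, rfl, hu', hu₂⟩ := hu.split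
        obtain ⟨u₁, w, rfl, hu₁, hw⟩ := hu'.split
        obtain ⟨b, rfl, hb, hev'⟩ := hw.observe_inv
        have hi : ∀ j, (ID.stmt k).left.Under j → (ID.stmt k).Under j := fun _ => ID.under_of_left
        have r₀ := ht₀.ready hwf hi
        have r := ht.ready hwf hi
        obtain ⟨a', k', q, x₁, hs', sim⟩ := h.stitches rfl hca r₀ r hs hu₁ (.refl _ _) hb
        have o₀ := (h.extract_spec rfl hca r₀).2.2.1
        have o := (k'.extract_spec rfl (q.closed hca) r).2.2.1
        have hv : b.val = a'.val := by rw [← AExpr.extract_val S a', x₁]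
        rw [x₁] at o
        rw [hv] at hev'
        simp only [Trace.bind_append, Trace.bind_observe, Trace.bind_nil] at hu₂
        have b₀ := ht₀.bind hi (h.labeled rfl) rfl o₀
        have b₁ := ht.bind hi (h.labeled rfl) hu₁.program_eq o
        obtain ⟨t, ht, hq, rfl⟩ := ih hrest hwf.2.2.2 ⟨b₀.agree, b₀.ok, b₀.fresh⟩
          ⟨b₁.agree, b₁.ok, b₁.fresh⟩ hs' (fun s hs => hc s (List.mem_cons_of_mem _ hs)) hu₂
        exact ⟨_, .observe k' hev' ht, .observe q hq, by simp [AStmt.extract, x₁]⟩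

theorem Top.nil (p : Prog D) (k : ℕ) : Top 𝒟 S β p k [] [] :=
  ⟨rfl, fun _ _ h => (by cases h), fun _ _ h => (by cases h)⟩

/-! ## Extraction loses no information -/

theorem AExpr.Labeled.under_extract {i : ID} {a : AExpr D} (h : a.Labeled i) (S : Set ID) :
    i.Under (a.extract S).2.id := by
  induction a generalizing i with
  | var | lam => exact h ▸ ID.under_refl _
  | appC a₁ a₂ a₃ j ih₁ ih₂ ih₃ =>
    obtain ⟨rfl, h₁, h₂, h₃⟩ := h
    simp only [AExpr.extract]
    split_ifs
    · exact ID.under_refl _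
    · exact ID.under_of_body (ih₃ h₃)
  | appS a₁ a₂ j ih₁ ih₂ => exact h.1 ▸ ID.under_refl _
  | dist d ρ a ev a' j ih ih' =>
    obtain ⟨rfl, h, h'⟩ := h
    simp only [AExpr.extract]
    split_ifs
    · exact ID.under_refl _
    · exact ID.under_of_body (ih' h')

/-- The test for extraction at `i`: the remaining expression has identifier `i` if the node was left
in place, and one at or below `i.body` if it was extracted. -/
theorem AExpr.Labeled.extract_id_ne {i : ID} {a : AExpr D} (h : a.Labeled i.body) (S : Set ID) :
    (a.extract S).2.id ≠ i := fun he => ID.not_body_self (he ▸ h.under_extract S)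

/-- The identifier of an expression. -/
def LExpr.id : LExpr D → ID
  | .var _ i => i
  | .lam _ _ i => i
  | .app _ _ i => i
  | .dist _ _ _ i => i

theorem AExpr.roll_id (a : AExpr D) : a.roll.id = a.id := by cases a <;> rfl

/-- The extracted program determines which parts have been extracted. -/
theorem AExpr.Labeled.extract_eq_of_roll_eq {i : ID} {a : AExpr D} (h : a.Labeled i)
    {M M' : LProg D}
    (hM : M ++ Trace.program (a.extract S).1 = M' ++ Trace.program (a.extract S').1)
    (he : (a.extract S).2.roll = (a.extract S').2.roll) :
    M = M' ∧ a.extract S = a.extract S' := by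
  -- The lengths of the two extracted lists are not known to agree in advance. Arbitrary prefixes
  -- `M`, `M'` allow the comparison to go from the end backwards, each part passing the rest on to
  -- its predecessor.
  induction a generalizing i M M' with
  | var | lam => simpa [AExpr.extract] using hM
  | appC a₁ a₂ a₃ j ih₁ ih₂ ih₃ =>
    obtain ⟨rfl, h₁, h₂, h₃⟩ := h
    have hid := congrArg LExpr.id he
    simp only [AExpr.roll_id] at hid
    by_cases hS : a₁.id ∈ S <;> by_cases hS' : a₁.id ∈ S' <;>
      simp only [AExpr.extract, hS, hS', if_true, if_false, Trace.program_append,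
        Trace.program_cons, Trace.program_nil, AStmt.roll, AExpr.roll, LExpr.app.injEq,
        ← List.append_assoc] at hM he hid ⊢
    · obtain ⟨hM, e₂⟩ := ih₂ h₂ hM he.2.1
      obtain ⟨hM, e₁⟩ := ih₁ h₁ hM he.1
      exact ⟨hM, by rw [e₁, e₂]⟩
    · exact absurd hid.symm (h₃.extract_id_ne S')
    · exact absurd hid (h₃.extract_id_ne S)
    · obtain ⟨hM, e₃⟩ := ih₃ h₃ hM he
      obtain ⟨hM, hx⟩ := List.append_inj' hM rfl
      simp only [List.cons.injEq, LStmt.assume.injEq, and_true, true_and] at hx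
      obtain ⟨hM, e₂⟩ := ih₂ h₂ hM hx
      obtain ⟨hM, hx⟩ := List.append_inj' hM rfl
      simp only [List.cons.injEq, LStmt.assume.injEq, and_true, true_and] at hx
      obtain ⟨hM, e₁⟩ := ih₁ h₁ hM hx
      exact ⟨hM, by rw [e₁, e₂, e₃]⟩
  | appS a₁ a₂ j ih₁ ih₂ =>
    obtain ⟨rfl, h₁, h₂⟩ := h
    simp only [AExpr.extract, Trace.program_append, AExpr.roll, LExpr.app.injEq,
        ← List.append_assoc] at hM he ⊢
    obtain ⟨hM, e₂⟩ := ih₂ h₂ hM he.2.1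
    obtain ⟨hM, e₁⟩ := ih₁ h₁ hM he.1
    exact ⟨hM, by rw [e₁, e₂]⟩
  | dist d ρ a ev a' j ih ih' =>
    obtain ⟨rfl, h, h'⟩ := h
    have hid := congrArg LExpr.id he
    simp only [AExpr.roll_id] at hid
    by_cases hS : j.choice ∈ S <;> by_cases hS' : j.choice ∈ S' <;>
      simp only [AExpr.extract, hS, hS', if_true, if_false, Trace.program_append,
        Trace.program_cons, Trace.program_nil, AStmt.roll, AExpr.roll, LExpr.dist.injEq,
        ← List.append_assoc] at hM he hid ⊢
    · obtain ⟨hM, e₁⟩ := ih h hM he.2.2.1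
      exact ⟨hM, by rw [e₁]⟩
    · exact absurd hid.symm (h'.extract_id_ne S')
    · exact absurd hid (h'.extract_id_ne S)
    · obtain ⟨hM, e₂⟩ := ih' h' hM he
      obtain ⟨hM, hx⟩ := List.append_inj' hM rfl
      simp only [List.cons.injEq, LStmt.observe.injEq, and_true, true_and] at hx
      obtain ⟨hM, e₁⟩ := ih h hM hx
      exact ⟨hM, by rw [e₁, e₂]⟩

theorem Trace.extract_eq_of_program_eq {t : Trace D} (h : ∀ s ∈ t, s.Labeled)
    (hM : Trace.program (Trace.extract t S) = Trace.program (Trace.extract t S')) :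
    Trace.extract t S = Trace.extract t S' := by
  suffices ∀ M M' : LProg D, M ++ Trace.program (Trace.extract t S) =
      M' ++ Trace.program (Trace.extract t S') → M = M' ∧ Trace.extract t S = Trace.extract t S' from
    (this [] [] (by simpa using hM)).2
  clear hM
  induction t with
  | nil => intro M M' hM; simpa using hM
  | cons s t ih =>
    intro M M' hM
    simp only [Trace.extract_cons, Trace.program_append, ← List.append_assoc] at hM ⊢
    obtain ⟨hM, ht⟩ := ih (fun s hs => h s (List.mem_cons_of_mem _ hs)) _ _ hM
    have hs := h s List.mem_cons_self
    rw [ht]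
    cases s with
    | assume x a =>
      obtain ⟨k, hk⟩ := hs
      simp only [AStmt.extract, Trace.program_append, Trace.program_cons, Trace.program_nil,
        AStmt.roll, ← List.append_assoc] at hM ⊢
      obtain ⟨hM, hx⟩ := List.append_inj' hM rfl
      simp only [List.cons.injEq, LStmt.assume.injEq, and_true, true_and] at hx
      obtain ⟨hM, e⟩ := hk.extract_eq_of_roll_eq hM hx
      exact ⟨hM, by rw [e]⟩
    | observe d a ev c =>
      obtain ⟨k, hk, -⟩ := hs
      simp only [AStmt.extract, Trace.program_append, Trace.program_cons, Trace.program_nil,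
        AStmt.roll, ← List.append_assoc] at hM ⊢
      obtain ⟨hM, hx⟩ := List.append_inj' hM rfl
      simp only [List.cons.injEq, LStmt.observe.injEq, and_true, true_and] at hx
      obtain ⟨hM, e⟩ := hk.extract_eq_of_roll_eq hM hx
      exact ⟨hM, by rw [e]⟩

/-- The equivalence leaves open only computed values and the parts selected by `S`, and both can be
read off the extract. Two sets `S`, `S'` are needed since equivalent traces may have different
subproblems. -/
theorem AExpr.Equiv.eq_of_extract_eq {a b : AExpr D} (h : AExpr.Equiv S a b) {i : ID}
    (ha : a.Labeled i) (hb : b.Labeled i) {M M' : Trace D}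
    (hM : M ++ (a.extract S).1 = M' ++ (b.extract S').1)
    (he : (a.extract S).2 = (b.extract S').2) : M = M' ∧ a = b := by
  induction h generalizing i M M' with
  | var | lam =>
    simp only [AExpr.extract] at he
    exact ⟨by simpa [AExpr.extract] using hM, he⟩
  | @appC a₁ a₂ a₃ b₁ b₂ b₃ j h h₁ h₂ h₃ ih₁ ih₂ ih₃ =>
    obtain ⟨rfl, ha₁, ha₂, ha₃⟩ := ha
    obtain ⟨-, hb₁, hb₂, hb₃⟩ := hb
    have hid := congrArg AExpr.id he
    by_cases hS' : b₁.id ∈ S' <;>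
      simp only [AExpr.extract, h, hS', if_true, if_false, ← List.append_assoc] at hM he hid
    · exact absurd hid (ha₃.extract_id_ne S)
    · replace hM := ih₃ ha₃ hb₃ hM he
      obtain ⟨hM, rfl⟩ := hM
      replace hM := List.append_inj' hM rfl
      obtain ⟨hM, hx⟩ := hM
      simp only [List.cons.injEq, AStmt.assume.injEq, and_true, true_and] at hx
      replace hM := ih₂ ha₂ hb₂ hM hx
      clear hx
      obtain ⟨hM, rfl⟩ := hM
      replace hM := List.append_inj' hM rfl
      obtain ⟨hM, hx⟩ := hM
      simp only [List.cons.injEq, AStmt.assume.injEq, and_true, true_and] at hx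
      replace hM := ih₁ ha₁ hb₁ hM hx
      obtain ⟨hM, rfl⟩ := hM
      exact ⟨hM, rfl⟩
  | appS h h₁ h₂ ih₁ ih₂ =>
    obtain ⟨rfl, ha₁, ha₂⟩ := ha
    obtain ⟨-, hb₁, hb₂⟩ := hb
    simp only [AExpr.extract, AExpr.appS.injEq, ← List.append_assoc] at hM he
    replace hM := ih₂ ha₂ hb₂ hM he.2.1
    obtain ⟨hM, rfl⟩ := hM
    replace hM := ih₁ ha₁ hb₁ hM he.1
    obtain ⟨hM, rfl⟩ := hM
    exact ⟨hM, rfl⟩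
  | @app_mem a a₁ a₂ b b₁ b₂ j h hxa hxb h₁ h₂ ih₁ ih₂ =>
    have hid := congrArg AExpr.id he
    rcases hxa with rfl | ⟨a₃, rfl⟩
    · obtain ⟨rfl, ha₁, ha₂⟩ := ha
      rcases hxb with rfl | ⟨b₃, rfl⟩
      · obtain ⟨-, hb₁, hb₂⟩ := hb
        simp only [AExpr.extract, AExpr.appS.injEq, ← List.append_assoc] at hM he
        replace hM := ih₂ ha₂ hb₂ hM he.2.1
        obtain ⟨hM, rfl⟩ := hM
        replace hM := ih₁ ha₁ hb₁ hM he.1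
        obtain ⟨hM, rfl⟩ := hM
        exact ⟨hM, rfl⟩
      · obtain ⟨-, hb₁, hb₂, hb₃⟩ := hb
        by_cases hS' : b₁.id ∈ S' <;>
          simp only [AExpr.extract, hS', if_true, if_false, reduceCtorEq] at he hid
        -- A symbolic application keeps the identifier `j`, which an extracted body cannot carry; an
        -- unextracted closure application has another constructor.
        exact absurd hid.symm (hb₃.extract_id_ne S')
    · obtain ⟨rfl, ha₁, ha₂, ha₃⟩ := ha
      rcases hxb with rfl | ⟨b₃, rfl⟩
      · simp only [AExpr.extract, h, if_true, reduceCtorEq] at he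
      · obtain ⟨-, hb₁, hb₂, hb₃⟩ := hb
        by_cases hS' : b₁.id ∈ S' <;>
          simp only [AExpr.extract, h, hS', if_true, if_false, AExpr.appC.injEq,
            ← List.append_assoc] at hM he hid
        · replace hM := ih₂ ha₂ hb₂ hM he.2.1
          obtain ⟨hM, rfl⟩ := hM
          replace hM := ih₁ ha₁ hb₁ hM he.1
          obtain ⟨hM, rfl⟩ := hM
          exact ⟨hM, by rw [he.2.2.1]⟩
        · exact absurd hid.symm (hb₃.extract_id_ne S')
  | @dist_notMem d ρ a a' b b' ev j h h₁ h₂ ih₁ ih₂ =>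
    obtain ⟨rfl, ha, ha'⟩ := ha
    obtain ⟨-, hb, hb'⟩ := hb
    have hid := congrArg AExpr.id he
    by_cases hS' : j.choice ∈ S' <;>
      simp only [AExpr.extract, h, hS', if_true, if_false, ← List.append_assoc] at hM he hid
    · exact absurd hid (ha'.extract_id_ne S)
    · replace hM := ih₂ ha' hb' hM he
      obtain ⟨hM, rfl⟩ := hM
      replace hM := List.append_inj' hM rfl
      obtain ⟨hM, hx⟩ := hM
      simp only [List.cons.injEq, AStmt.observe.injEq, and_true, true_and] at hx
      replace hM := ih₁ ha hb hM hx
      obtain ⟨hM, rfl⟩ := hM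
      exact ⟨hM, rfl⟩
  | @dist_mem d ρ a a' b b' ev ev' j h h₁ ih =>
    obtain ⟨rfl, ha, ha'⟩ := ha
    obtain ⟨-, hb, hb'⟩ := hb
    have hid := congrArg AExpr.id he
    by_cases hS' : j.choice ∈ S' <;>
      simp only [AExpr.extract, h, hS', if_true, if_false, AExpr.dist.injEq] at hM he hid
    · obtain ⟨-, -, e, rfl, rfl, -⟩ := he
      replace hM := ih ha hb hM e
      obtain ⟨hM, rfl⟩ := hM
      exact ⟨hM, rfl⟩
    · exact absurd hid.symm (hb'.extract_id_ne S')

/-- Equivalent traces from which the same trace is extracted are equal. -/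
theorem Exec.eq_of_extract_eq {p : Prog D} {k : ℕ} {σ σ' : Env D} {t t' : Trace D}
    (ht : Exec 𝒟 σ (Prog.labelFrom k p) t) (ht' : Exec 𝒟 σ' (Prog.labelFrom k p) t')
    (h : Trace.Equiv S t t') (he : Trace.extract t S = Trace.extract t' S') : t = t' := by
  suffices ∀ M M' : Trace D, M ++ Trace.extract t S = M' ++ Trace.extract t' S' →
      M = M' ∧ t = t' from (this [] [] (by simpa using he)).2
  clear he
  induction p generalizing k σ σ' t t' with
  | nil => cases ht; cases ht'; intro M M' hM; simpa using hM
  | cons s p ih =>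
    intro M M' hM
    cases s with
    | assume x e =>
      cases ht with
      | assume h₁ h₂ =>
      cases ht' with
      | assume h₁' h₂' =>
      cases h with
      | assume q h =>
      simp only [Trace.extract_cons, AStmt.extract, ← List.append_assoc] at hM
      replace hM := ih h₂ h₂' h _ _ hM
      obtain ⟨hM, rfl⟩ := hM
      replace hM := List.append_inj' hM rfl
      obtain ⟨hM, hx⟩ := hM
      simp only [List.cons.injEq, AStmt.assume.injEq, and_true, true_and] at hx
      replace hM := q.eq_of_extract_eq (h₁.labeled rfl) (h₁'.labeled rfl) hM hx
      obtain ⟨hM, rfl⟩ := hM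
      exact ⟨hM, rfl⟩
    | observe d e ev =>
      cases ht with
      | observe h₁ _ h₂ =>
      cases ht' with
      | observe h₁' _ h₂' =>
      cases h with
      | observe q h =>
      simp only [Trace.extract_cons, AStmt.extract, ← List.append_assoc] at hM
      replace hM := ih h₂ h₂' h _ _ hM
      obtain ⟨hM, rfl⟩ := hM
      replace hM := List.append_inj' hM rfl
      obtain ⟨hM, hx⟩ := hM
      simp only [List.cons.injEq, AStmt.observe.injEq, and_true, true_and] at hx
      replace hM := q.eq_of_extract_eq (h₁.labeled rfl) (h₁'.labeled rfl) hM hx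
      obtain ⟨hM, rfl⟩ := hM
      exact ⟨hM, rfl⟩

/-! ## Extraction preserves the density -/

@[simp] theorem Trace.pdf_nil : Trace.pdf 𝒟 [] = 1 := rfl

@[simp] theorem Trace.pdf_cons (s : AStmt D) (t : Trace D) :
    Trace.pdf 𝒟 (s :: t) = s.pdf 𝒟 * Trace.pdf 𝒟 t := by
  simp [Trace.pdf]

@[simp] theorem Trace.pdf_append (t u : Trace D) :
    Trace.pdf 𝒟 (t ++ u) = Trace.pdf 𝒟 t * Trace.pdf 𝒟 u := by
  simp [Trace.pdf]

/-- The factor of a draw reappears as the factor of the observation that replaces it, since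
extraction keeps the parameter value; all other factors are only rearranged. -/
theorem AExpr.pdf_extract (S : Set ID) (a : AExpr D) :
    Trace.pdf 𝒟 (a.extract S).1 * (a.extract S).2.pdf 𝒟 = a.pdf 𝒟 := by
  induction a with
  | var | lam => simp [AExpr.extract, AExpr.pdf]
  | appC a₁ a₂ a₃ j ih₁ ih₂ ih₃ =>
    simp only [AExpr.extract]
    split_ifs <;> simp only [AExpr.pdf, ← ih₁, ← ih₂, ← ih₃, Trace.pdf_append, Trace.pdf_cons,
      Trace.pdf_nil, AStmt.pdf] <;> ring
  | appS a₁ a₂ j ih₁ ih₂ =>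
    simp only [AExpr.extract, AExpr.pdf, ← ih₁, ← ih₂, Trace.pdf_append]
    ring
  | dist d ρ a ev a' j ih ih' =>
    simp only [AExpr.extract]
    split_ifs <;> simp only [AExpr.pdf, ← ih, ← ih', Trace.pdf_append, Trace.pdf_cons,
      Trace.pdf_nil, AStmt.pdf, AExpr.extract_val] <;> ring

theorem Trace.pdf_extract (S : Set ID) (t : Trace D) :
    Trace.pdf 𝒟 (Trace.extract t S) = Trace.pdf 𝒟 t := by
  induction t with
  | nil => rfl
  | cons s t ih =>
    cases s with
    | assume x a =>
      simp [AStmt.extract, AStmt.pdf, ih, ← AExpr.pdf_extract S a, mul_assoc]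
    | observe d a ev c =>
      simp only [Trace.extract_cons, AStmt.extract, Trace.pdf_append, Trace.pdf_cons,
        Trace.pdf_nil, AStmt.pdf, ih, AExpr.extract_val, ← AExpr.pdf_extract S a]
      ring

end ProbLang

namespace ProbLang

variable {D : Type u} {𝒟 : Dists D}

/-! ## The bijection between a class and the traces of its subprogram -/

section Class

variable {p : Prog D} {SS : TraceSpace 𝒟 (Prog.label p) → Set ID} {hrev : Reversible SS}
  {c : Quotient hrev.setoid} {ps : LProg D}

theorem exec_extract (hp : Prog.WellFormed 𝒟 p) (hSS : ∀ t, ValidSubproblem t.1 (SS t))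
    (hps : ∀ t ∈ hrev.part c, Trace.program (Trace.extract t.1 (SS t)) = ps)
    (t : hrev.part c) : Exec 𝒟 [] ps (Trace.extract t.1.1 (SS t.1)) := by
  rw [← hps t.1 t.2]
  exact Exec.extract (p := p) t.1.2 hp (.nil p 0)
    ((hSS t.1).closed (Exec.labeled (p := p) t.1.2))

theorem equiv_of_mem_part {t t' : TraceSpace 𝒟 (Prog.label p)} (ht : t ∈ hrev.part c)
    (ht' : t' ∈ hrev.part c) : Trace.Equiv (SS t) t.1 t'.1 :=
  Quotient.exact (s := hrev.setoid) (Eq.trans ht (Eq.symm ht'))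

theorem extract_injective {t t' : hrev.part c}
    (h : Trace.extract t.1.1 (SS t.1) = Trace.extract t'.1.1 (SS t'.1)) : t = t' :=
  Subtype.ext (Subtype.ext (Exec.eq_of_extract_eq (p := p) t.1.2 t'.1.2
    (equiv_of_mem_part t.2 t'.2) h))

theorem exists_extract_eq (hp : Prog.WellFormed 𝒟 p) (hSS : ∀ t, ValidSubproblem t.1 (SS t))
    (hps : ∀ t ∈ hrev.part c, Trace.program (Trace.extract t.1 (SS t)) = ps)
    (hne : (hrev.part c).Nonempty) {u : Trace D} (hu : Exec 𝒟 [] ps u) :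
    ∃ t : hrev.part c, Trace.extract t.1.1 (SS t.1) = u := by
  obtain ⟨t₀, ht₀⟩ := hne
  have hcl := (hSS t₀).closed (Exec.labeled (p := p) t₀.2)
  obtain ⟨t, ht, hq, hx⟩ := Exec.stitch (p := p) (S := SS t₀) (u := u) t₀.2 hp (.nil p 0)
    (.nil p 0) (fun _ _ => .inl ⟨rfl, rfl⟩) hcl (by rwa [hps t₀ ht₀])
  have hc : (⟨t, ht⟩ : TraceSpace 𝒟 (Prog.label p)) ∈ hrev.part c :=
    (Quotient.sound (s := hrev.setoid) hq).symm.trans ht₀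
  refine ⟨⟨⟨t, ht⟩, hc⟩, ?_⟩
  rw [← hx]
  -- So far `u` is the extract along `SS t₀`; the subproblem of the new trace may be a different
  -- set. Both extracts have program `ps`, which makes them equal.
  refine Trace.extract_eq_of_program_eq (Exec.labeled (p := p) ht) ?_
  rw [hx, hu.program_eq]
  exact hps _ hc

/-- Extraction, as a bijection of a class with the traces of its subprogram. -/
noncomputable def extractEquiv (hp : Prog.WellFormed 𝒟 p)
    (hSS : ∀ t, ValidSubproblem t.1 (SS t))
    (hps : ∀ t ∈ hrev.part c, Trace.program (Trace.extract t.1 (SS t)) = ps)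
    (hne : (hrev.part c).Nonempty) : hrev.part c ≃ TraceSpace 𝒟 ps :=
  Equiv.ofBijective (fun t => ⟨Trace.extract t.1.1 (SS t.1), exec_extract hp hSS hps t⟩)
    ⟨fun _ _ h => extract_injective (congrArg Subtype.val h), fun u =>
      (exists_extract_eq hp hSS hps hne u.2).imp fun _ h => Subtype.ext h⟩

end Class

/-! ## Measures of sets of traces -/

theorem traceMeasure_apply (P : LProg D) (A : Set (TraceSpace 𝒟 P)) :
    traceMeasure 𝒟 P A =
      (∑' t : TraceSpace 𝒟 P, Trace.pdf 𝒟 t.1)⁻¹ * ∑' t : A, Trace.pdf 𝒟 t.1.1 := by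
  rw [traceMeasure, Measure.smul_apply, smul_eq_mul,
    Measure.sum_apply _ (MeasurableSpace.measurableSet_top),
    tsum_subtype A fun t => Trace.pdf 𝒟 t.1]
  congr 1
  refine tsum_congr fun t => ?_
  rw [Measure.smul_apply, Measure.dirac_apply' _ MeasurableSpace.measurableSet_top]
  by_cases h : t ∈ A <;> simp [h]

theorem measurableSet_part {P : LProg D} {T : Set (TraceSpace 𝒟 P)} (A : Set T) :
    MeasurableSet A :=
  ⟨Subtype.val '' A, MeasurableSpace.measurableSet_top,
    Set.preimage_image_eq _ Subtype.val_injective⟩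

/-- A density preserving bijection transports the conditional distribution. -/
theorem condMeasure_apply {P Q : LProg D} {T : Set (TraceSpace 𝒟 P)} (hT : 0 < traceMeasure 𝒟 P T)
    (e : T ≃ TraceSpace 𝒟 Q) (he : ∀ t, Trace.pdf 𝒟 (e t).1 = Trace.pdf 𝒟 t.1.1) (A : Set T) :
    condMeasure T A = traceMeasure 𝒟 Q (e '' A) := by
  have hcomap : (traceMeasure 𝒟 P).comap Subtype.val A = traceMeasure 𝒟 P (Subtype.val '' A) :=
    Measure.comap_apply _ Subtype.val_injective
      (fun _ _ => MeasurableSpace.measurableSet_top) _ (measurableSet_part A)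
  rw [condMeasure, Measure.smul_apply, smul_eq_mul, hcomap]
  simp only [traceMeasure_apply] at hT ⊢
  rw [tsum_image (fun t : TraceSpace 𝒟 P => Trace.pdf 𝒟 t.1) Subtype.val_injective.injOn,
    tsum_image (fun t : TraceSpace 𝒟 Q => Trace.pdf 𝒟 t.1) e.injective.injOn,
    ← e.tsum_eq fun t => Trace.pdf 𝒟 t.1]
  simp only [he]
  set Z := ∑' t : TraceSpace 𝒟 P, Trace.pdf 𝒟 t.1
  -- Positive mass of the class excludes both `Z = ∞` and `Z = 0`, so the constant `Z⁻¹` cancels and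
  -- only the total density of the class remains as normalization.
  have hZ : Z⁻¹ ≠ 0 := fun h => by simp [h] at hT
  have hZ' : Z⁻¹ ≠ ∞ := by
    intro h
    have h0 : Z = 0 := ENNReal.inv_eq_top.1 h
    have : ∀ t : TraceSpace 𝒟 P, Trace.pdf 𝒟 t.1 = 0 := ENNReal.tsum_eq_zero.1 h0
    simp [this] at hT
  rw [ENNReal.mul_inv (.inl hZ) (.inl hZ'), mul_mul_mul_comm, ENNReal.inv_mul_cancel hZ hZ',
    one_mul]

/-! ## Transport of Markov kernels along bijections -/

section Transport

variable {X Y : Type*} [MeasurableSpace X] [MeasurableSpace Y]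

/-- A kernel on `Y`, transported to `X`. -/
noncomputable def transport (e : X ≃ᵐ Y) (K : Kernel Y Y) : Kernel X X :=
  (K.comap e e.measurable).map e.symm

theorem transport_apply (e : X ≃ᵐ Y) (K : Kernel Y Y) (x : X) {A : Set X} (hA : MeasurableSet A) :
    transport e K x A = K (e x) (e '' A) := by
  rw [transport, Kernel.map_apply' _ e.symm.measurable _ hA, Kernel.comap_apply]
  congr 1
  exact (e.toEquiv.image_eq_preimage_symm A).symm

/-- Change of variables in the intermediate state. It makes transport commute with iteration, as
irreducibility requires. -/
theorem transport_mul (e : X ≃ᵐ Y) (K L : Kernel Y Y) :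
    transport e (K * L) = transport e K * transport e L := by
  ext x A hA
  change transport e (K ∘ₖ L) x A = (transport e K ∘ₖ transport e L) x A
  rw [transport_apply e _ x hA,
    Kernel.comp_apply' _ _ _ (e.measurableSet_image.2 hA), Kernel.comp_apply' _ _ _ hA,
    transport, transport, Kernel.map_apply _ e.symm.measurable, lintegral_map_equiv,
    Kernel.comap_apply]
  refine lintegral_congr fun y => ?_
  rw [← transport, transport_apply e _ _ hA, e.apply_symm_apply]

theorem transport_pow (e : X ≃ᵐ Y) (K : Kernel Y Y) {n : ℕ} (hn : 1 ≤ n) :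
    transport e (K ^ n) = transport e K ^ n := by
  induction n, hn using Nat.le_induction with
  | base => simp
  | succ n _ ih => rw [pow_succ, transport_mul, ih, pow_succ]

variable {e : X ≃ᵐ Y} {π : Measure Y} {ν : Measure X} {K : Kernel Y Y}

theorem IsIrreducible.transport (hν : ∀ A, MeasurableSet A → ν A = π (e '' A))
    (h : IsIrreducible π K) : IsIrreducible ν (transport e K) := by
  intro x A hA hpos
  rw [hν A hA] at hpos
  obtain ⟨n, hn, hK⟩ := h (e x) (e '' A) (e.measurableSet_image.2 hA) hpos
  refine ⟨n, hn, ?_⟩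
  rwa [← transport_pow e K hn, transport_apply e _ x hA]

/-- Contrapositive: the image under `e` of a cyclic decomposition is a cyclic decomposition for `K`.
-/
theorem IsAperiodic.transport (hν : ∀ A, MeasurableSet A → ν A = π (e '' A))
    (h : IsAperiodic π K) : IsAperiodic ν (transport e K) := by
  rintro ⟨d, E, N, hd, hE, hN, hdisj, hdN, hU, h0, hK⟩
  refine h ⟨d, fun i => e '' E i, e '' N, hd,
    fun i => ⟨e.measurableSet_image.2 (hE i).1, (hE i).2.image e⟩, e.measurableSet_image.2 hN,
    fun i j hij => (Set.disjoint_image_iff e.injective).2 (hdisj i j hij),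
    fun i => (Set.disjoint_image_iff e.injective).2 (hdN i), ?_, by rw [← hν N hN, h0], ?_⟩
  · rw [← Set.image_iUnion, ← Set.image_union, hU, Set.image_univ, e.surjective.range_eq]
  · rintro i j hij _ ⟨x, hx, rfl⟩
    rw [← transport_apply e K x (hE j).1]
    exact hK i j hij x hx

theorem invariant_transport (hν : ∀ A, MeasurableSet A → ν A = π (e '' A))
    (h : Kernel.Invariant K π) : Kernel.Invariant (transport e K) ν := by
  have hmap : ν = π.map e.symm := by
    ext A hA
    rw [e.symm.map_apply, hν A hA]
    exact congrArg π (e.toEquiv.image_eq_preimage_symm A)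
  refine Measure.ext fun A hA => ?_
  rw [Measure.bind_apply hA (Kernel.aemeasurable _), hν A hA]
  conv_rhs => rw [← h, Measure.bind_apply (e.measurableSet_image.2 hA) (Kernel.aemeasurable _)]
  rw [hmap, lintegral_map_equiv]
  refine lintegral_congr fun y => ?_
  rw [transport_apply e K _ hA, e.apply_symm_apply]

instance [IsMarkovKernel K] : IsMarkovKernel (transport e K) :=
  Kernel.IsMarkovKernel.map _ e.symm.measurable

end Transport

end ProbLang

/-! ### Conclusion: the kernel conjugated by extraction -/

theorem mainTheorem10 {D : Type u} (𝒟 : ProbLang.Dists D) (p : ProbLang.Prog D)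
    (hp : ProbLang.Prog.WellFormed 𝒟 p)
    (SS : ProbLang.TraceSpace 𝒟 (ProbLang.Prog.label p) → Set ProbLang.ID)
    (hSS : ∀ t, ProbLang.ValidSubproblem t.1 (SS t))
    (hrev : ProbLang.Reversible SS)
    (c : Quotient hrev.setoid)
    (hc : 0 < ProbLang.traceMeasure 𝒟 (ProbLang.Prog.label p) (hrev.part c))
    (ps : ProbLang.LProg D)
    (hps : ∀ t ∈ hrev.part c, ProbLang.Trace.program (ProbLang.Trace.extract t.1 (SS t)) = ps)
    (K : Kernel (ProbLang.TraceSpace 𝒟 ps) (ProbLang.TraceSpace 𝒟 ps)) (hK : IsMarkovKernel K)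
    (hirr : ProbLang.IsIrreducible (ProbLang.traceMeasure 𝒟 ps) K)
    (haper : ProbLang.IsAperiodic (ProbLang.traceMeasure 𝒟 ps) K)
    (hstat : Kernel.Invariant K (ProbLang.traceMeasure 𝒟 ps)) :
    ∃ ext : hrev.part c → ProbLang.TraceSpace 𝒟 ps,
      (∀ t : hrev.part c, (ext t).1 = ProbLang.Trace.extract t.1.1 (SS t.1)) ∧
      ∃ Kc : Kernel (hrev.part c) (hrev.part c),
        IsMarkovKernel Kc ∧
        (∀ (t : hrev.part c) (A : Set (hrev.part c)), MeasurableSet A →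
          Kc t A = K (ext t) (ext '' A)) ∧
        ProbLang.IsIrreducible (ProbLang.condMeasure (hrev.part c)) Kc ∧
        ProbLang.IsAperiodic (ProbLang.condMeasure (hrev.part c)) Kc ∧
        Kernel.Invariant Kc (ProbLang.condMeasure (hrev.part c)) := by
  -- Surjectivity of extraction needs a template trace in the class.
  have hne : (hrev.part c).Nonempty := by
    rw [Set.nonempty_iff_ne_empty]
    intro h
    simp [h] at hc
  let e₀ := ProbLang.extractEquiv hp hSS hps hne
  let e : hrev.part c ≃ᵐ ProbLang.TraceSpace 𝒟 ps :=
    { toEquiv := e₀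
      measurable_toFun := fun _ _ => ProbLang.measurableSet_part _
      measurable_invFun := fun _ _ => MeasurableSpace.measurableSet_top }
  have hν : ∀ A, MeasurableSet A →
      ProbLang.condMeasure (hrev.part c) A = ProbLang.traceMeasure 𝒟 ps (e '' A) := fun A _ =>
    ProbLang.condMeasure_apply hc e₀ (fun t => ProbLang.Trace.pdf_extract (SS t.1) t.1.1) A
  exact ⟨e, fun _ => rfl, ProbLang.transport e K, inferInstance,
    fun t A hA => ProbLang.transport_apply e K t hA, hirr.transport hν, haper.transport hν,
    ProbLang.invariant_transport hν hstat⟩
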